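/- Let $K$ be a field. For an additive $K$-category $\mathcal C$, a $\mathcal C$-module is an additive functor $\mathcal C\to\mathbf{Ab}$. A filtration of $\mathcal C$ is a chain $0=\mathcal C_0\subseteq\mathcal C_1\subseteq\cdots$ of full subcategories, each closed under isomorphisms, finite direct sums and direct summands, with $\bigcup_j\mathcal C_j=\mathcal C$. Let $I_{\mathcal C_j}$ be the ideal of morphisms that factor through an object of $\mathcal C_j$. A two-sided ideal $I$ is heredity if $I^2=I$, $I\cdot\mathrm{rad}\cdot I=0$ and every module $I(X,-)$ is finitely generated projective; $\mathcal C$ is quasi-hereditary with respect to $\{\mathcal C_j\}$ if $I_{\mathcal C_j}/I_{\mathcal C_{j-1}}$ is a heredity ideal of $\mathcal C/I_{\mathcal C_{j-1}}$ for all $j\ge 1$. For $j\ge1$ the class ${}_{\mathcal C}\Delta(j)$ consists of the standard modules $\mathcal C(E,-)/I_{\mathcal C_{j-1}}(E,-)$ with $E$ indecomposable in $\mathcal C_j$ and not in $\mathcal C_{j-1}$, and ${}_{\mathcal C}\Delta=\bigcup_{j\ge1}{}_{\mathcal C}\Delta(j)$. A module $F$ is $\Delta$-filtered if it has a chain of submodules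 $0=F_0\subseteq F_1\subseteq\cdots$ with $\bigcup_jF_j=F$ such that every $F_{j+1}/F_j$ is a finite direct sum of modules in ${}_{\mathcal C}\Delta$; it is finitely $\Delta$-filtered if such a chain exists with $F_m=F$ for some $m$. The trace filtration of $F$ is $\{F^{[j]}\}_{j\ge0}$, where $F^{[j]}$ is the sum of the images of all morphisms $\mathcal C(E,-)\to F$ with $E\in\mathcal C_j$; $F$ is trace-$\Delta$-filtered if $F^{[j]}/F^{[j-1]}$ is a finite direct sum of modules in ${}_{\mathcal C}\Delta(j)$ for all $j\ge1$. Let $\mathcal T$ and $\mathcal U$ be Hom-finite Krull–Schmidt $K$-categories that are quasi-hereditary with respect to filtrations $\{\mathcal T_j\}_{j\ge0}$ and $\{\mathcal U_j\}_{0\le j\le n}$ (so $\mathcal U_n=\mathcal U$). Let $M:\mathcal U\otimes_K\mathcal T^{op}\to\mathrm{mod}\,K$ be a $K$-linear functor such that the $\mathcal U$-module $M_T=M(-,T)$ is $\Delta$-filtered for every $T\in\mathcal T$. Let $\Lambda=\left(\begin{smallmatrix}\mathcal T&0\\ M&\mathcal U\end{smallmatrix}\right)$ be the triangular matrix category: its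 objects are pairs $(T,U)$; its morphisms $(T,U)\to(T',U')$ are the matrices $\left(\begin{smallmatrix}f&0\\ m&g\end{smallmatrix}\right)$ with $f\in\mathcal T(T,T')$, $m\in M(U',T)$, $g\in\mathcal U(U,U')$; composition is matrix multiplication. Give it the filtration $\Lambda_j=\{(0,U):U\in\mathcal U_j\}$ for $0\le j\le n$, and $\Lambda_{n+j}=\{(T,U):T\in\mathcal T_j,\ U\in\mathcal U\}$ for $j\ge1$. Consider triples $(F^{(1)},f,F^{(2)})$ consisting of a $\mathcal T$-module $F^{(1)}$, a $\mathcal U$-module $F^{(2)}$ and a natural transformation $f:F^{(1)}\to\mathrm{Hom}_{\mathcal U}(M_{(-)},F^{(2)})$. Such a triple defines the $\Lambda$-module $(T,U)\mapsto F^{(1)}(T)\oplus F^{(2)}(U)$, on which $\left(\begin{smallmatrix}\varphi&0\\ m&g\end{smallmatrix}\right)$ acts by $(x,y)\mapsto(F^{(1)}(\varphi)(x),\,f(x)(m)+F^{(2)}(g)(y))$. Conversely, a $\Lambda$-module $F$ defines the triple with $F^{(1)}(T)=F(T,0)$, $F^{(2)}(U)=F(0,U)$ and $f(x)(m)=F\left(\begin{smallmatrix}0&0\\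 m&0\end{smallmatrix}\right)(x)$. Every $\Lambda$-module is isomorphic to the module of its triple. Let $F$ be a $\Lambda$-module isomorphic to the module of the triple $(F^{(1)},f,F^{(2)})$, and let $\{F^{[j]}\}_{j\ge0}$ be its trace filtration with respect to $\{\Lambda_j\}$. Then: (i) $(F^{[j]})^{(1)}\cong0$ if $0\le j\le n$, and, if $j>n$, the inclusion $F^{[j]}\subseteq F$ induces an isomorphism on $\mathcal U$-components, so that $(F^{[j]})^{(2)}\cong F^{(2)}$. (ii) If $F$ is $\Delta$-filtered over $\Lambda$, then $F^{(1)}$ is $\Delta$-filtered over $\mathcal T$ and $F^{(2)}$ is $\Delta$-filtered over $\mathcal U$. Likewise, if $F$ is trace-$\Delta$-filtered, then so are $F^{(1)}$ and $F^{(2)}$. (iii) $F$ is finitely $\Delta$-filtered over $\Lambda$ if and only if $F^{(1)}$ is finitely $\Delta$-filtered over $\mathcal T$ and $F^{(2)}$ is finitely $\Delta$-filtered over $\mathcal U$. -/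

import Mathlib

open CategoryTheory CategoryTheory.Limits Opposite

universe v u u₁ u₂ w

noncomputable section

namespace TriQH

open ZeroObject

attribute [local instance] CategoryTheory.Limits.hasBinaryBiproducts_of_finite_biproducts

/-! ### Modules over an additive category, submodules and quotients

A `C`-module is an additive functor `F : C ⥤ AddCommGrpCat`. -/

section Modules

variable {C : Type u} [Category.{v} C] [Preadditive C]

/-- The representable module `C(E, -)`. -/
def rep (E : C) : C ⥤ AddCommGrpCat.{v} where
  obj Y := AddCommGrpCat.of (E ⟶ Y)
  map f := AddCommGrpCat.ofHom
    { toFun := fun g => g ≫ f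
      map_zero' := zero_comp
      map_add' := fun _ _ => Preadditive.add_comp _ _ _ _ _ _ }
  map_id _ := by ext g; exact Category.comp_id g
  map_comp _ _ := by ext g; exact (Category.assoc g _ _).symm

instance (E : C) : (rep E).Additive where
  map_add := by intro X Y f g; ext h; exact Preadditive.comp_add _ _ _ _ _ _

/-- A submodule of a `C`-module. -/
@[ext]
structure Submod (F : C ⥤ AddCommGrpCat.{v}) where
  carrier : ∀ X : C, AddSubgroup (F.obj X)
  map_mem : ∀ {X Y : C} (f : X ⟶ Y) (x : F.obj X), x ∈ carrier X → (F.map f).hom x ∈ carrier Y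

namespace Submod

variable {F : C ⥤ AddCommGrpCat.{v}}

/-- A submodule, regarded as a module. -/
def toFunctor (N : Submod F) : C ⥤ AddCommGrpCat.{v} where
  obj X := AddCommGrpCat.of (N.carrier X)
  map {X Y} f := AddCommGrpCat.ofHom
    (((F.map f).hom.comp (N.carrier X).subtype).codRestrict (N.carrier Y)
      (fun x => N.map_mem f x.1 x.2))
  map_id X := by ext x; change (F.map (𝟙 X)).hom x.1 = x.1; simp
  map_comp f g := by
    ext x
    change (F.map (f ≫ g)).hom x.1 = (F.map g).hom ((F.map f).hom x.1); simp

instance (N : Submod F) [F.Additive] : N.toFunctor.Additive where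
  map_add := by
    intro X Y f g; ext x; apply Subtype.ext
    change (F.map (f + g)).hom x.1 = (F.map f).hom x.1 + (F.map g).hom x.1
    rw [F.map_add]; rfl

/-- The inclusion of a submodule. -/
def ι (N : Submod F) : N.toFunctor ⟶ F where
  app X := AddCommGrpCat.ofHom (N.carrier X).subtype
  naturality _ _ _ := by ext x; rfl

/-- The quotient module `F / N`. -/
def quot (N : Submod F) : C ⥤ AddCommGrpCat.{v} where
  obj X := AddCommGrpCat.of (F.obj X ⧸ N.carrier X)
  map {X Y} f := AddCommGrpCat.ofHom
    (QuotientAddGroup.map (N.carrier X) (N.carrier Y) (F.map f).hom (fun x hx => N.map_mem f x hx))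
  map_id X := by
    ext x
    change QuotientAddGroup.mk ((F.map (𝟙 X)).hom x) = QuotientAddGroup.mk x
    simp
  map_comp f g := by
    ext x
    change QuotientAddGroup.mk ((F.map (f ≫ g)).hom x) =
      QuotientAddGroup.mk ((F.map g).hom ((F.map f).hom x))
    simp

/-- For submodules `L ⊆ N` of `F`, the quotient module `N / L`. -/
def subquot (L N : Submod F) : C ⥤ AddCommGrpCat.{v} :=
  Submod.quot (F := N.toFunctor)
    { carrier := fun X => (L.carrier X).addSubgroupOf (N.carrier X)
      map_mem := fun f x hx => L.map_mem f x.1 hx }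

end Submod

/-- The trace of the family `{C(E, -) : P E}` in `F`: the sum of the images of all morphisms
`C(E, -) ⟶ F` with `P E`. -/
def trace (P : ObjectProperty C) (F : C ⥤ AddCommGrpCat.{v}) : Submod F where
  carrier X := ⨆ (E : C) (_ : P E) (η : rep E ⟶ F), (η.app X).hom.range
  map_mem {X Y} f x hx := by
    have key : (⨆ (E : C) (_ : P E) (η : rep E ⟶ F), (η.app X).hom.range) ≤
        (⨆ (E : C) (_ : P E) (η : rep E ⟶ F), (η.app Y).hom.range).comap (F.map f).hom := by
      refine iSup_le fun E => iSup_le fun hE => iSup_le fun η => ?_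
      rintro _ ⟨g, rfl⟩
      refine AddSubgroup.mem_iSup_of_mem E (AddSubgroup.mem_iSup_of_mem hE
        (AddSubgroup.mem_iSup_of_mem η ⟨((rep E).map f).hom g, ?_⟩))
      exact congrArg (fun φ => φ.hom g) (η.naturality f)
    exact key hx

/-- `F` is finitely generated: finitely many elements generate it (equivalently, it is a quotient
of a finite direct sum of representable modules). -/
def FinGen (F : C ⥤ AddCommGrpCat.{v}) : Prop :=
  ∃ (m : ℕ) (E : Fin m → C) (x : ∀ i, F.obj (E i)),
    ∀ (Y : C) (y : F.obj Y), ∃ g : ∀ i, E i ⟶ Y, y = ∑ i, (F.map (g i)).hom (x i)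

instance : HasFiniteBiproducts (C ⥤ AddCommGrpCat.{v}) :=
  HasFiniteBiproducts.of_hasFiniteProducts

/-- `𝒳^⨿`: the modules that are finite direct sums of modules in the class `𝒳`. -/
def FinSum (𝒳 : (C ⥤ AddCommGrpCat.{v}) → Prop) (F : C ⥤ AddCommGrpCat.{v}) : Prop :=
  ∃ (m : ℕ) (S : Fin m → (C ⥤ AddCommGrpCat.{v})), (∀ i, 𝒳 (S i)) ∧ Nonempty (F ≅ ⨁ S)

/-- An ascending chain of submodules of `F`, starting at `0`, whose successive quotients are
finite direct sums of modules in `𝒳`. -/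
structure IsChain (𝒳 : (C ⥤ AddCommGrpCat.{v}) → Prop) {F : C ⥤ AddCommGrpCat.{v}}
    (c : ℕ → Submod F) : Prop where
  mono : ∀ j X, (c j).carrier X ≤ (c (j + 1)).carrier X
  zero : ∀ X, (c 0).carrier X = ⊥
  step : ∀ j, FinSum 𝒳 (Submod.subquot (c j) (c (j + 1)))

/-- `F` is `𝒳`-filtered. -/
def Filtered (𝒳 : (C ⥤ AddCommGrpCat.{v}) → Prop) (F : C ⥤ AddCommGrpCat.{v}) : Prop :=
  ∃ c : ℕ → Submod F, IsChain 𝒳 c ∧ ∀ (X : C) (x : F.obj X), ∃ j, x ∈ (c j).carrier X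

/-- `F` is finitely `𝒳`-filtered. -/
def FinFiltered (𝒳 : (C ⥤ AddCommGrpCat.{v}) → Prop) (F : C ⥤ AddCommGrpCat.{v}) : Prop :=
  ∃ c : ℕ → Submod F, IsChain 𝒳 c ∧ ∃ m, ∀ X, (c m).carrier X = ⊤

end Modules

/-! ### Two-sided ideals, quotient categories, heredity ideals -/

section Ideals

variable (K : Type w) [Field K] (C : Type u) [Category.{v} C] [Preadditive C] [Linear K C]

/-- A two-sided ideal of a `K`-category. -/
structure CatIdeal where
  carrier : ∀ X Y : C, Submodule K (X ⟶ Y)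
  mem_comp : ∀ {X Y Z : C} (f : X ⟶ Y) (g : Y ⟶ Z), f ∈ carrier X Y → f ≫ g ∈ carrier X Z
  comp_mem : ∀ {X Y Z : C} (f : X ⟶ Y) (g : Y ⟶ Z), g ∈ carrier Y Z → f ≫ g ∈ carrier X Z

variable {K C}

namespace CatIdeal

/-- `f ∼ g` if and only if `f - g` lies in the ideal. -/
def rel (I : CatIdeal K C) : HomRel C := fun X Y f g => f - g ∈ I.carrier X Y

instance (I : CatIdeal K C) : Congruence I.rel where
  equivalence :=
    { refl := fun f => by simp [rel]
      symm := fun {f g} h => by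
        have := (I.carrier _ _).neg_mem h
        rwa [neg_sub] at this
      trans := fun {f g h} h₁ h₂ => by
        have := (I.carrier _ _).add_mem h₁ h₂
        rwa [sub_add_sub_cancel] at this }
  comp_left f g g' h := by
    have := I.comp_mem f _ h
    rwa [Preadditive.comp_sub] at this
  comp_right g h := by
    have := I.mem_comp _ g h
    rwa [Preadditive.sub_comp] at this

/-- The quotient category `C / I`. -/
abbrev Quot (I : CatIdeal K C) := CategoryTheory.Quotient I.rel

theorem rel_add (I : CatIdeal K C) ⦃X Y : C⦄ (f₁ f₂ g₁ g₂ : X ⟶ Y) (h : I.rel f₁ f₂)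
    (h' : I.rel g₁ g₂) : I.rel (f₁ + g₁) (f₂ + g₂) := by
  have := (I.carrier _ _).add_mem h h'
  change f₁ + g₁ - (f₂ + g₂) ∈ _
  rwa [add_sub_add_comm]

theorem rel_smul (I : CatIdeal K C) (a : K) ⦃X Y : C⦄ (f₁ f₂ : X ⟶ Y) (h : I.rel f₁ f₂) :
    I.rel (a • f₁) (a • f₂) := by
  have := (I.carrier _ _).smul_mem a h
  rwa [smul_sub] at this

instance (I : CatIdeal K C) : Preadditive I.Quot := Quotient.preadditive I.rel I.rel_add

instance (I : CatIdeal K C) : (Quotient.functor I.rel).Additive :=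
  Quotient.functor_additive I.rel I.rel_add

instance (I : CatIdeal K C) : Linear K I.Quot := Quotient.linear K I.rel I.rel_smul

instance (I : CatIdeal K C) : (Quotient.functor I.rel).Linear K :=
  Quotient.linear_functor K I.rel I.rel_smul

/-- The image `(I + J) / J` of an ideal `I` in the quotient category `C / J`. -/
def quotient (I J : CatIdeal K C) : CatIdeal K J.Quot where
  carrier X Y := (I.carrier X.as Y.as).map ((Quotient.functor J.rel).mapLinearMap K)
  mem_comp {X Y Z} f g hf := by
    obtain ⟨f, hf, rfl⟩ := hf
    obtain ⟨g, rfl⟩ := (Quotient.functor J.rel).map_surjective (X := Y.as) (Y := Z.as) g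
    exact ⟨f ≫ g, I.mem_comp f g hf, (Quotient.functor J.rel).map_comp f g⟩
  comp_mem {X Y Z} f g hg := by
    obtain ⟨g, hg, rfl⟩ := hg
    obtain ⟨f, rfl⟩ := (Quotient.functor J.rel).map_surjective (X := X.as) (Y := Y.as) f
    exact ⟨f ≫ g, I.comp_mem f g hg, (Quotient.functor J.rel).map_comp f g⟩

/-- The submodule `I(X, -)` of the representable module `C(X, -)`. -/
def sub (I : CatIdeal K C) (X : C) : Submod (rep X) where
  carrier Y := (I.carrier X Y).toAddSubgroup
  map_mem f g hg := I.mem_comp g f hg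

end CatIdeal

/-- Membership in the Jacobson radical of a preadditive category. -/
def InRad {C : Type u} [Category.{v} C] [Preadditive C] {X Y : C} (h : X ⟶ Y) : Prop :=
  ∀ g : Y ⟶ X, IsIso (𝟙 X - h ≫ g)

/-- (Left) heredity ideals: `I² = I`, `I · rad · I = 0`, and all the modules `I(X, -)` are
finitely generated and projective in the category of modules (additive functors). -/
structure CatIdeal.IsHeredity (I : CatIdeal K C) : Prop where
  idem : ∀ X Y : C, Submodule.span K
    {h : X ⟶ Y | ∃ (Z : C) (f : X ⟶ Z) (g : Z ⟶ Y),
      f ∈ I.carrier X Z ∧ g ∈ I.carrier Z Y ∧ f ≫ g = h} = I.carrier X Y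
  rad : ∀ {W X Y Z : C} (f : W ⟶ X) (r : X ⟶ Y) (g : Y ⟶ Z),
    f ∈ I.carrier W X → InRad r → g ∈ I.carrier Y Z → f ≫ r ≫ g = 0
  finGen : ∀ X : C, FinGen (I.sub X).toFunctor
  proj : ∀ X : C, Projective (AdditiveFunctor.of (I.sub X).toFunctor)

end Ideals

/-! ### Krull-Schmidt and quasi-hereditary categories, standard modules -/

section QuasiHereditary

/-- `Hom`-finiteness over `K`. -/
def HomFinite (K : Type w) [Field K] (C : Type u) [Category.{v} C] [Preadditive C]
    [Linear K C] : Prop :=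
  ∀ X Y : C, Module.Finite K (X ⟶ Y)

/-- Every object is a finite direct sum of objects with local endomorphism rings (which are
then indecomposable). -/
def KrullSchmidt (C : Type u) [Category.{v} C] [Preadditive C] [HasFiniteBiproducts C] : Prop :=
  ∀ X : C, ∃ (m : ℕ) (S : Fin m → C), (∀ i, IsLocalRing (End (S i))) ∧ Nonempty (X ≅ ⨁ S)

/-- An exhaustive ascending filtration `0 = C₀ ⊆ C₁ ⊆ C₂ ⊆ ⋯` of `C` by additively closed full
subcategories (closed under isomorphisms, finite direct sums and direct summands). -/
structure AddFiltration (C : Type u) [Category.{v} C] [Preadditive C]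
    [HasFiniteBiproducts C] where
  level : ℕ → ObjectProperty C
  mono : ∀ j X, level j X → level (j + 1) X
  exhaustive : ∀ X, ∃ j, level j X
  zero_iff : ∀ X, level 0 X ↔ IsZero X
  of_iso : ∀ j X Y, (X ≅ Y) → level j X → level j Y
  biprod : ∀ j X Y, level j X → level j Y → level j (X ⊞ Y)
  summand : ∀ j X Y, level j (X ⊞ Y) → level j X

variable {C : Type u} [Category.{v} C] [Preadditive C] [HasFiniteBiproducts C]

theorem AddFiltration.zero_mem (𝒞 : AddFiltration C) (j : ℕ) : 𝒞.level j (0 : C) := by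
  induction j with
  | zero => exact (𝒞.zero_iff _).2 (isZero_zero C)
  | succ j ih => exact 𝒞.mono j _ ih

variable (K : Type w) [Field K] [Linear K C]

/-- The ideal of all morphisms that factor through an object of the `j`-th subcategory. -/
def AddFiltration.ideal (𝒞 : AddFiltration C) (j : ℕ) : CatIdeal K C where
  carrier X Y :=
    { carrier := {f | ∃ (E : C) (a : X ⟶ E) (b : E ⟶ Y), 𝒞.level j E ∧ a ≫ b = f}
      zero_mem' := ⟨0, 0, 0, 𝒞.zero_mem j, by simp⟩
      add_mem' := by
        rintro _ _ ⟨E, a, b, hE, rfl⟩ ⟨E', a', b', hE', rfl⟩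
        exact ⟨E ⊞ E', biprod.lift a a', biprod.desc b b', 𝒞.biprod j _ _ hE hE', by simp⟩
      smul_mem' := by
        rintro c _ ⟨E, a, b, hE, rfl⟩
        exact ⟨E, a, c • b, hE, by simp⟩ }
  mem_comp := by
    rintro X Y Z _ g ⟨E, a, b, hE, rfl⟩
    exact ⟨E, a, b ≫ g, hE, by simp⟩
  comp_mem := by
    rintro X Y Z f _ ⟨E, a, b, hE, rfl⟩
    exact ⟨E, f ≫ a, b, hE, by simp⟩

/-- `C` is quasi-hereditary with respect to the filtration: with `I j` the ideal of the `j`-th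
subcategory, `I (j + 1) / I j` is a heredity ideal of `C / I j` for all `j`. -/
def QuasiHereditary (𝒞 : AddFiltration C) : Prop :=
  ∀ j, ((𝒞.ideal K (j + 1)).quotient (𝒞.ideal K j)).IsHeredity

/-- The modules `Δ_E(j + 1) = C(E, -) / I j (E, -)`, with `E` an indecomposable object of the
`(j + 1)`-st subcategory that does not lie in the `j`-th one, up to isomorphism. -/
def StandardAt (𝒞 : AddFiltration C) (j : ℕ) (S : C ⥤ AddCommGrpCat.{v}) : Prop :=
  ∃ E : C, Indecomposable E ∧ 𝒞.level (j + 1) E ∧ ¬ 𝒞.level j E ∧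
    Nonempty (S ≅ ((𝒞.ideal K j).sub E).quot)

/-- The class of standard modules. -/
def Standard (𝒞 : AddFiltration C) (S : C ⥤ AddCommGrpCat.{v}) : Prop :=
  ∃ j, StandardAt K 𝒞 j S

/-- The `j`-th term `F^[j]` of the trace filtration of `F`. -/
def traceAt (𝒞 : AddFiltration C) (F : C ⥤ AddCommGrpCat.{v}) (j : ℕ) : Submod F :=
  trace (𝒞.level j) F

/-- The successive quotients `F^[j + 1] / F^[j]` of the trace filtration are finite direct sums of
standard modules of level `j + 1`. -/
def TraceFiltered (𝒞 : AddFiltration C) (F : C ⥤ AddCommGrpCat.{v}) : Prop :=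
  ∀ j, FinSum (StandardAt K 𝒞 j) (Submod.subquot (traceAt 𝒞 F j) (traceAt 𝒞 F (j + 1)))

end QuasiHereditary

/-! ### Triangular matrix categories -/

section Triangular

variable (K : Type w) [Field K]
  (T : Type u₁) [Category.{v} T] [Preadditive T] [Linear K T]
  (U : Type u₂) [Category.{v} U] [Preadditive U] [Linear K U]

/-- A `K`-linear functor `U ⊗ Tᵒᵖ ⥤ Mod K`, that is, a functor of two variables which is
`K`-linear in each of them. -/
structure Bimod where
  functor : Tᵒᵖ ⥤ U ⥤ ModuleCat.{v} K
  additive : ∀ t, (functor.obj t).Additive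
  linear : ∀ t, (functor.obj t).Linear K
  map_add : ∀ {t t' : T} (f g : t ⟶ t'),
    functor.map (f + g).op = functor.map f.op + functor.map g.op
  map_smul : ∀ {t t' : T} (a : K) (f : t ⟶ t'), functor.map (a • f).op = a • functor.map f.op

variable {K T U}

namespace Bimod

variable (M : Bimod K T U)

instance (t : Tᵒᵖ) : (M.functor.obj t).Additive := M.additive t
instance (t : Tᵒᵖ) : (M.functor.obj t).Linear K := M.linear t

/-- The vector space `M(u, t)`. -/
abbrev val (t : T) (u : U) : ModuleCat.{v} K := (M.functor.obj (op t)).obj u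

/-- `g • m = M(g ⊗ 1)(m)`. -/
def left {t : T} {u u' : U} (g : u ⟶ u') : M.val t u →ₗ[K] M.val t u' :=
  ((M.functor.obj (op t)).map g).hom

/-- `m • f = M(1 ⊗ fᵒᵖ)(m)`. -/
def right {t t' : T} {u : U} (f : t ⟶ t') : M.val t' u →ₗ[K] M.val t u :=
  ((M.functor.map f.op).app u).hom

/-- The `U`-module `M_t = M(-, t)`. -/
def col (t : T) : U ⥤ AddCommGrpCat.{v} :=
  M.functor.obj (op t) ⋙ forget₂ (ModuleCat.{v} K) AddCommGrpCat.{v}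

instance (t : T) : (M.col t).Additive := by unfold col; infer_instance

/-- The morphism of `U`-modules `M_{t'} ⟶ M_t` induced by `f : t ⟶ t'`. -/
def colMap {t t' : T} (f : t ⟶ t') : M.col t' ⟶ M.col t :=
  Functor.whiskerRight (M.functor.map f.op) (forget₂ (ModuleCat.{v} K) AddCommGrpCat.{v})

variable {M}

@[simp] theorem left_id {t : T} {u : U} (m : M.val t u) : M.left (𝟙 u) m = m := by simp [left]

@[simp] theorem left_comp {t : T} {u u' u'' : U} (g : u ⟶ u') (g' : u' ⟶ u'') (m : M.val t u) :
    M.left (g ≫ g') m = M.left g' (M.left g m) := by simp [left]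

@[simp] theorem right_id {t : T} {u : U} (m : M.val t u) : M.right (𝟙 t) m = m := by simp [right]

@[simp] theorem right_comp {t t' t'' : T} {u : U} (f : t ⟶ t') (f' : t' ⟶ t'')
    (m : M.val t'' u) : M.right (f ≫ f') m = M.right f (M.right f' m) := by simp [right]

theorem right_left {t t' : T} {u u' : U} (f : t ⟶ t') (g : u ⟶ u') (m : M.val t' u) :
    M.right f (M.left g m) = M.left g (M.right f m) := by
  have := congrArg (fun φ => φ.hom m) ((M.functor.map f.op).naturality g)
  simpa [left, right] using this

@[simp] theorem left_add {t : T} {u u' : U} (g g' : u ⟶ u') (m : M.val t u) :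
    M.left (g + g') m = M.left g m + M.left g' m := by
  simp [left, (M.functor.obj (op t)).map_add]

@[simp] theorem left_smul {t : T} {u u' : U} (a : K) (g : u ⟶ u') (m : M.val t u) :
    M.left (a • g) m = a • M.left g m := by
  simp [left, (M.functor.obj (op t)).map_smul]

@[simp] theorem right_add {t t' : T} {u : U} (f f' : t ⟶ t') (m : M.val t' u) :
    M.right (f + f') m = M.right f m + M.right f' m := by
  unfold right; rw [M.map_add]; simp

@[simp] theorem right_smul {t t' : T} {u : U} (a : K) (f : t ⟶ t') (m : M.val t' u) :
    M.right (a • f) m = a • M.right f m := by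
  unfold right; rw [M.map_smul]; simp

@[simp] theorem left_zero {t : T} {u u' : U} (m : M.val t u) :
    M.left (0 : u ⟶ u') m = 0 := by simp [left]

@[simp] theorem right_zero {t t' : T} {u : U} (m : M.val t' u) :
    M.right (0 : t ⟶ t') m = 0 := by
  simpa using right_smul (M := M) (0 : K) (0 : t ⟶ t') m

end Bimod

/-- The triangular matrix category `Λ = (T 0; M U)`: its objects are pairs of an object of `T` and
an object of `U`. -/
structure Tri (M : Bimod K T U) where
  fst : T
  snd : U

namespace Tri

variable {M : Bimod K T U}

/-- A morphism `(f 0; m g)` is given by `f : T ⟶ T'`, `m ∈ M(U', T)` and `g : U ⟶ U'`. -/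
@[ext]
structure Hom (X Y : Tri M) : Type v where
  f : X.fst ⟶ Y.fst
  m : M.val X.fst Y.snd
  g : X.snd ⟶ Y.snd

/-- Composition: `(f₂ 0; m₂ g₂) ∘ (f₁ 0; m₁ g₁) = (f₂f₁ 0; m₂•f₁ + g₂•m₁ g₂g₁)`. -/
instance : Category.{v} (Tri M) where
  Hom := Hom
  id X := ⟨𝟙 _, 0, 𝟙 _⟩
  comp a b := ⟨a.f ≫ b.f, M.right a.f b.m + M.left b.g a.m, a.g ≫ b.g⟩
  id_comp a := by ext <;> simp
  comp_id a := by ext <;> simp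
  assoc a b c := by
    ext
    · simp
    · simp [Bimod.right_left, add_assoc]
    · simp

@[ext] theorem hom_ext {X Y : Tri M} {a b : X ⟶ Y} (hf : a.f = b.f) (hm : a.m = b.m)
    (hg : a.g = b.g) : a = b := Hom.ext hf hm hg

@[simp] theorem id_f (X : Tri M) : Hom.f (𝟙 X) = 𝟙 X.fst := rfl
@[simp] theorem id_m (X : Tri M) : Hom.m (𝟙 X) = 0 := rfl
@[simp] theorem id_g (X : Tri M) : Hom.g (𝟙 X) = 𝟙 X.snd := rfl
@[simp] theorem comp_f {X Y Z : Tri M} (a : X ⟶ Y) (b : Y ⟶ Z) : (a ≫ b).f = a.f ≫ b.f := rfl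
@[simp] theorem comp_m {X Y Z : Tri M} (a : X ⟶ Y) (b : Y ⟶ Z) :
    (a ≫ b).m = M.right a.f b.m + M.left b.g a.m := rfl
@[simp] theorem comp_g {X Y Z : Tri M} (a : X ⟶ Y) (b : Y ⟶ Z) : (a ≫ b).g = a.g ≫ b.g := rfl

/-- A morphism of `Λ` as a triple. -/
def homEquiv (X Y : Tri M) :
    (X ⟶ Y) ≃ (X.fst ⟶ Y.fst) × M.val X.fst Y.snd × (X.snd ⟶ Y.snd) where
  toFun a := (a.f, a.m, a.g)
  invFun p := ⟨p.1, p.2.1, p.2.2⟩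
  left_inv _ := rfl
  right_inv _ := rfl

/-- Addition and scalar multiplication of morphisms are entrywise. -/
instance (X Y : Tri M) : AddCommGroup (X ⟶ Y) := (homEquiv X Y).addCommGroup

instance (X Y : Tri M) : Module K (X ⟶ Y) := (homEquiv X Y).module K

@[simp] theorem add_f {X Y : Tri M} (a b : X ⟶ Y) : (a + b).f = a.f + b.f := rfl
@[simp] theorem add_m {X Y : Tri M} (a b : X ⟶ Y) : (a + b).m = a.m + b.m := rfl
@[simp] theorem add_g {X Y : Tri M} (a b : X ⟶ Y) : (a + b).g = a.g + b.g := rfl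
@[simp] theorem zero_f (X Y : Tri M) : Hom.f (0 : X ⟶ Y) = 0 := rfl
@[simp] theorem zero_m (X Y : Tri M) : Hom.m (0 : X ⟶ Y) = 0 := rfl
@[simp] theorem zero_g (X Y : Tri M) : Hom.g (0 : X ⟶ Y) = 0 := rfl
@[simp] theorem smul_f {X Y : Tri M} (c : K) (a : X ⟶ Y) : (c • a).f = c • a.f := rfl
@[simp] theorem smul_m {X Y : Tri M} (c : K) (a : X ⟶ Y) : (c • a).m = c • a.m := rfl
@[simp] theorem smul_g {X Y : Tri M} (c : K) (a : X ⟶ Y) : (c • a).g = c • a.g := rfl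

instance : Preadditive (Tri M) where
  add_comp _ _ _ a b c := by ext <;> simp; abel
  comp_add _ _ _ a b c := by ext <;> simp; abel

instance : Linear K (Tri M) where
  smul_comp _ _ _ c a b := by ext <;> simp
  comp_smul _ _ _ a c b := by ext <;> simp

/-- The diagonal projections of `Λ`. -/
def fstFunctor (M : Bimod K T U) : Tri M ⥤ T where
  obj X := X.fst
  map a := a.f

/-- The diagonal projections of `Λ`. -/
def sndFunctor (M : Bimod K T U) : Tri M ⥤ U where
  obj X := X.snd
  map a := a.g

instance : (fstFunctor M).Additive where
instance : (sndFunctor M).Additive where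

theorem isZero_iff (X : Tri M) : IsZero X ↔ IsZero X.fst ∧ IsZero X.snd := by
  rw [IsZero.iff_id_eq_zero, IsZero.iff_id_eq_zero, IsZero.iff_id_eq_zero]
  constructor
  · intro h
    exact ⟨congrArg Hom.f h, congrArg Hom.g h⟩
  · rintro ⟨h₁, h₂⟩
    ext
    · exact h₁
    · rfl
    · exact h₂

variable [HasFiniteBiproducts T] [HasFiniteBiproducts U]

instance : HasBinaryBiproducts (Tri M) where
  has_binary_biproduct X Y := hasBinaryBiproduct_of_total
    { pt := ⟨X.fst ⊞ Y.fst, X.snd ⊞ Y.snd⟩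
      fst := ⟨biprod.fst, 0, biprod.fst⟩
      snd := ⟨biprod.snd, 0, biprod.snd⟩
      inl := ⟨biprod.inl, 0, biprod.inl⟩
      inr := ⟨biprod.inr, 0, biprod.inr⟩
      inl_fst := by ext <;> simp
      inl_snd := by ext <;> simp
      inr_fst := by ext <;> simp
      inr_snd := by ext <;> simp }
    (by ext <;> simp)

instance : HasZeroObject (Tri M) :=
  ⟨⟨⟨0, 0⟩, (isZero_iff _).2 ⟨isZero_zero T, isZero_zero U⟩⟩⟩

instance : HasFiniteBiproducts (Tri M) :=
  have : HasFiniteProducts (Tri M) := hasFiniteProducts_of_has_binary_and_terminal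
  HasFiniteBiproducts.of_hasFiniteProducts

/-- `(X ⊕ Y)` has diagonal entries `X.fst ⊕ Y.fst` and `X.snd ⊕ Y.snd`. -/
def biprodFst (X Y : Tri M) : (X ⊞ Y).fst ≅ X.fst ⊞ Y.fst :=
  haveI := preservesBinaryBiproduct_of_preservesBiproduct (fstFunctor M) X Y
  (fstFunctor M).mapBiprod X Y

/-- `(X ⊕ Y)` has diagonal entries `X.fst ⊕ Y.fst` and `X.snd ⊕ Y.snd`. -/
def biprodSnd (X Y : Tri M) : (X ⊞ Y).snd ≅ X.snd ⊞ Y.snd :=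
  haveI := preservesBinaryBiproduct_of_preservesBiproduct (sndFunctor M) X Y
  (sndFunctor M).mapBiprod X Y

/-- The filtration of `Λ`: `Λ_j = (0 0; M U_j)` for `j ≤ n`, and `Λ_{n+j} = (T_j 0; M U)` for
`j ≥ 1`, where `U_n = U`. -/
def filtration (M : Bimod K T U) (𝒯 : AddFiltration T) (𝒰 : AddFiltration U) (n : ℕ)
    (hn : ∀ u, 𝒰.level n u) : AddFiltration (Tri M) where
  level j X := if j ≤ n then IsZero X.fst ∧ 𝒰.level j X.snd else 𝒯.level (j - n) X.fst
  mono j X h := by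
    by_cases h₁ : j + 1 ≤ n
    · rw [if_pos (by omega)] at h
      rw [if_pos h₁]
      exact ⟨h.1, 𝒰.mono j _ h.2⟩
    · rw [if_neg h₁]
      by_cases h₂ : j ≤ n
      · rw [if_pos h₂] at h
        obtain rfl : j = n := by omega
        rw [show j + 1 - j = 0 + 1 by omega]
        exact 𝒯.mono 0 _ ((𝒯.zero_iff _).2 h.1)
      · rw [if_neg h₂] at h
        rw [show j + 1 - n = (j - n) + 1 by omega]
        exact 𝒯.mono _ _ h
  exhaustive X := by
    obtain ⟨j, hj⟩ := 𝒯.exhaustive X.fst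
    refine ⟨n + (j + 1), ?_⟩
    rw [if_neg (by omega), show n + (j + 1) - n = j + 1 by omega]
    exact 𝒯.mono j _ hj
  zero_iff X := by
    rw [if_pos (Nat.zero_le n), isZero_iff, 𝒰.zero_iff]
  of_iso j X Y e h := by
    have e₁ : X.fst ≅ Y.fst := (fstFunctor M).mapIso e
    have e₂ : X.snd ≅ Y.snd := (sndFunctor M).mapIso e
    split_ifs at h ⊢
    · exact ⟨h.1.of_iso e₁.symm, 𝒰.of_iso j _ _ e₂ h.2⟩
    · exact 𝒯.of_iso _ _ _ e₁ h
  biprod j X Y hX hY := by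
    split_ifs at hX hY ⊢
    · refine ⟨?_, 𝒰.of_iso j _ _ (biprodSnd X Y).symm (𝒰.biprod j _ _ hX.2 hY.2)⟩
      have := 𝒯.biprod 0 _ _ ((𝒯.zero_iff _).2 hX.1) ((𝒯.zero_iff _).2 hY.1)
      exact ((𝒯.zero_iff _).1 this).of_iso (biprodFst X Y)
    · exact 𝒯.of_iso _ _ _ (biprodFst X Y).symm (𝒯.biprod _ _ _ hX hY)
  summand j X Y h := by
    split_ifs at h ⊢
    · refine ⟨?_, 𝒰.summand j _ _ (𝒰.of_iso j _ _ (biprodSnd X Y) h.2)⟩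
      have := (𝒯.zero_iff _).2 (h.1.of_iso (biprodFst X Y).symm)
      exact (𝒯.zero_iff _).1 (𝒯.summand 0 _ _ this)
    · exact 𝒯.summand _ _ _ (𝒯.of_iso _ _ _ (biprodFst X Y) h)

/-- The embedding `T ⥤ Λ`, `t ↦ (t 0; M 0)`. -/
def inT (M : Bimod K T U) : T ⥤ Tri M where
  obj t := ⟨t, 0⟩
  map f := ⟨f, 0, 0⟩
  map_id _ := by ext <;> simp
  map_comp _ _ := by ext <;> simp

/-- The embedding `U ⥤ Λ`, `u ↦ (0 0; M u)`. -/
def inU (M : Bimod K T U) : U ⥤ Tri M where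
  obj u := ⟨0, u⟩
  map g := ⟨0, 0, g⟩
  map_id _ := by ext <;> simp
  map_comp _ _ := by ext <;> simp

instance : (inT M).Additive where
  map_add := by
    intro X Y f g
    apply hom_ext
    · rfl
    · exact (add_zero _).symm
    · exact (add_zero _).symm

instance : (inU M).Additive where
  map_add := by
    intro X Y f g
    apply hom_ext
    · exact (add_zero _).symm
    · exact (add_zero _).symm
    · rfl

end Tri

/-- The triples `(F₁, f, F₂)`: a `T`-module `F₁`, a `U`-module `F₂` and a natural transformation
`f : F₁ ⟶ 𝔾 F₂`, where `(𝔾 F₂)(t) = Hom_U(M_t, F₂)`. -/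
structure Triple (M : Bimod K T U) where
  fst : T ⥤ AddCommGrpCat.{v}
  snd : U ⥤ AddCommGrpCat.{v}
  fst_additive : fst.Additive
  snd_additive : snd.Additive
  f : ∀ t : T, fst.obj t →+ (M.col t ⟶ snd)
  naturality : ∀ {t t' : T} (φ : t ⟶ t') (x : fst.obj t),
    f t' ((fst.map φ).hom x) = M.colMap φ ≫ f t x

namespace Triple

variable {M : Bimod K T U}

instance (A : Triple M) : A.fst.Additive := A.fst_additive
instance (A : Triple M) : A.snd.Additive := A.snd_additive

/-- For `x ∈ F₁(t)` and `m ∈ M(u, t)`, the element `f(x)(m)` of `F₂(u)`. -/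
def act (A : Triple M) (t : T) (u : U) (x : A.fst.obj t) (m : M.val t u) : A.snd.obj u :=
  ((A.f t x).app u).hom m

variable (A : Triple M)

theorem act_add_left {t : T} {u : U} (x y : A.fst.obj t) (m : M.val t u) :
    A.act t u (x + y) m = A.act t u x m + A.act t u y m := by
  unfold act; rw [map_add]; rfl

theorem act_add_right {t : T} {u : U} (x : A.fst.obj t) (m m' : M.val t u) :
    A.act t u x (m + m') = A.act t u x m + A.act t u x m' :=
  map_add ((A.f t x).app u).hom m m'

theorem act_zero_left {t : T} {u : U} (m : M.val t u) : A.act t u 0 m = 0 := by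
  unfold act; rw [map_zero]; rfl

theorem act_zero_right {t : T} {u : U} (x : A.fst.obj t) : A.act t u x 0 = 0 :=
  map_zero ((A.f t x).app u).hom

theorem act_left {t : T} {u u' : U} (x : A.fst.obj t) (m : M.val t u) (g : u ⟶ u') :
    A.act t u' x (M.left g m) = (A.snd.map g).hom (A.act t u x m) :=
  congrArg (fun φ => φ.hom m) ((A.f t x).naturality g)

theorem act_right {t t' : T} {u : U} (φ : t ⟶ t') (x : A.fst.obj t) (m : M.val t' u) :
    A.act t' u ((A.fst.map φ).hom x) m = A.act t u x (M.right φ m) := by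
  unfold act; rw [A.naturality]; rfl

/-- The `Λ`-module of a triple: its value at `(t 0; M u)` is `F₁(t) × F₂(u)`, and the morphism
`(φ 0; m g)` acts by `(x, y) ↦ (F₁(φ)(x), f(x)(m) + F₂(g)(y))`. -/
def toModule : Tri M ⥤ AddCommGrpCat.{v} where
  obj X := AddCommGrpCat.of (A.fst.obj X.fst × A.snd.obj X.snd)
  map {X Y} a := AddCommGrpCat.ofHom
    { toFun := fun p => ((A.fst.map a.f).hom p.1,
        A.act X.fst Y.snd p.1 a.m + (A.snd.map a.g).hom p.2)
      map_zero' := by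
        ext
        · simp
        · simp [act_zero_left]
      map_add' := by
        intro p q
        ext
        · simp
        · simp only [Prod.fst_add, Prod.snd_add, act_add_left, map_add]; abel }
  map_id X := by
    ext p
    · change (A.fst.map (𝟙 X.fst)).hom p.1 = p.1
      simp
    · change A.act X.fst X.snd p.1 0 + (A.snd.map (𝟙 X.snd)).hom p.2 = p.2
      simp [act_zero_right]
  map_comp {X Y Z} a b := by
    ext p
    · change (A.fst.map (a.f ≫ b.f)).hom p.1 = (A.fst.map b.f).hom ((A.fst.map a.f).hom p.1)
      simp
    · change A.act X.fst Z.snd p.1 (M.right a.f b.m + M.left b.g a.m) +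
          (A.snd.map (a.g ≫ b.g)).hom p.2 =
        A.act Y.fst Z.snd ((A.fst.map a.f).hom p.1) b.m +
          (A.snd.map b.g).hom (A.act X.fst Y.snd p.1 a.m + (A.snd.map a.g).hom p.2)
      rw [act_right, act_add_right, act_left, map_add, A.snd.map_comp, add_assoc]
      rfl

instance : A.toModule.Additive where
  map_add := by
    intro X Y a b
    ext p
    apply Prod.ext
    · change (A.fst.map (a.f + b.f)).hom p.1 = (A.fst.map a.f).hom p.1 + (A.fst.map b.f).hom p.1
      rw [A.fst.map_add]; rfl
    · change A.act X.fst Y.snd p.1 (a.m + b.m) + (A.snd.map (a.g + b.g)).hom p.2 =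
        (A.act X.fst Y.snd p.1 a.m + (A.snd.map a.g).hom p.2) +
          (A.act X.fst Y.snd p.1 b.m + (A.snd.map b.g).hom p.2)
      rw [act_add_right, A.snd.map_add]
      change _ + ((A.snd.map a.g).hom p.2 + (A.snd.map b.g).hom p.2) = _
      abel

variable [HasFiniteBiproducts T] [HasFiniteBiproducts U]

/-- The triple of a `Λ`-module `F`: `F₁(t) = F(t 0; M 0)`, `F₂(u) = F(0 0; M u)`, and
`f(x)(m) = F(0 0; m 0)(x)`. -/
def ofModule (F : Tri M ⥤ AddCommGrpCat.{v}) [F.Additive] : Triple M where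
  fst := Tri.inT M ⋙ F
  snd := Tri.inU M ⋙ F
  fst_additive := inferInstance
  snd_additive := inferInstance
  f t :=
    { toFun := fun x =>
        { app := fun u => AddCommGrpCat.ofHom
            { toFun := fun m => (F.map (X := (Tri.inT M).obj t) (Y := (Tri.inU M).obj u)
                ⟨0, m, 0⟩).hom x
              map_zero' := by
                change (F.map (0 : (Tri.inT M).obj t ⟶ (Tri.inU M).obj u)).hom x = 0
                rw [F.map_zero]; rfl
              map_add' := fun m m' => by
                have : (⟨0, m + m', 0⟩ : (Tri.inT M).obj t ⟶ (Tri.inU M).obj u) =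
                    (show (Tri.inT M).obj t ⟶ (Tri.inU M).obj u from ⟨0, m, 0⟩) +
                      (show (Tri.inT M).obj t ⟶ (Tri.inU M).obj u from ⟨0, m', 0⟩) := by
                  apply Tri.hom_ext
                  · exact (add_zero _).symm
                  · rfl
                  · exact (add_zero _).symm
                rw [this, F.map_add]; rfl }
          naturality := fun u u' g => by
            ext m
            change (F.map (X := (Tri.inT M).obj t) (Y := (Tri.inU M).obj u')
                ⟨0, M.left g m, 0⟩).hom x = (F.map ((Tri.inU M).map g)).hom
                  ((F.map (X := (Tri.inT M).obj t) (Y := (Tri.inU M).obj u) ⟨0, m, 0⟩).hom x)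
            have : (⟨0, M.left g m, 0⟩ : (Tri.inT M).obj t ⟶ (Tri.inU M).obj u') =
                (show (Tri.inT M).obj t ⟶ (Tri.inU M).obj u from ⟨0, m, 0⟩) ≫
                  (Tri.inU M).map g := by
              apply Tri.hom_ext
              · exact zero_comp.symm
              · simp [Tri.inU]
              · exact zero_comp.symm
            rw [this, F.map_comp]; rfl }
      map_zero' := by ext u m; exact map_zero (F.map _).hom
      map_add' := fun x y => by ext u m; exact map_add (F.map _).hom x y }
  naturality {t t'} φ x := by
    ext u m
    change (F.map (X := (Tri.inT M).obj t') (Y := (Tri.inU M).obj u) ⟨0, m, 0⟩).hom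
        ((F.map ((Tri.inT M).map φ)).hom x) =
      (F.map (X := (Tri.inT M).obj t) (Y := (Tri.inU M).obj u) ⟨0, M.right φ m, 0⟩).hom x
    have : (⟨0, M.right φ m, 0⟩ : (Tri.inT M).obj t ⟶ (Tri.inU M).obj u) =
        (Tri.inT M).map φ ≫
          (show (Tri.inT M).obj t' ⟶ (Tri.inU M).obj u from ⟨0, m, 0⟩) := by
      apply Tri.hom_ext
      · exact comp_zero.symm
      · simp [Tri.inT]
      · exact zero_comp.symm
    rw [this, F.map_comp]; rfl

end Triple

end Triangular

end TriQH

end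

/-!
An indecomposable object of the triangular matrix category `Λ` is of the form `(t, 0)` or `(0, u)`.
Hence the standard `Λ`-modules of the levels `n + j` are the standard `𝒯`-modules inflated along
`Λ ⥤ T`, and those of the levels below `n` are the standard `𝒰`-modules inflated along `Λ ⥤ U`.
Restriction along `T ⥤ Λ` or `U ⥤ Λ` is exact and sends a standard module to a standard module or
to zero, so it sends (finite) filtrations to (finite) filtrations; it also commutes with traces.
Conversely, the module of a triple `(F₁, f, F₂)` is an extension of the inflation of `F₁` by the
inflation of `F₂`, and finitely filtered modules are closed under extensions.
-/

noncomputable section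

namespace TriQH

open ZeroObject

attribute [local instance] CategoryTheory.Limits.hasBinaryBiproducts_of_finite_biproducts

/-! ### Submodules along morphisms and functors -/

section Modules

variable {C : Type u} [Category.{v} C]

theorem isIso_of_bijective_app {F F' : C ⥤ AddCommGrpCat.{v}} (η : F ⟶ F')
    (h : ∀ X, Function.Bijective (η.app X).hom) : IsIso η :=
  (NatTrans.isIso_iff_isIso_app η).2 fun X => (ConcreteCategory.isIso_iff_bijective _).2 (h X)

theorem bijective_app {F F' : C ⥤ AddCommGrpCat.{v}} (η : F ⟶ F') [IsIso η] (X : C) :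
    Function.Bijective (η.app X).hom :=
  (ConcreteCategory.isIso_iff_bijective (η.app X)).1 inferInstance

theorem isZero_of_subsingleton_obj {F : C ⥤ AddCommGrpCat.{v}}
    (h : ∀ X, Subsingleton (F.obj X)) : IsZero F :=
  (Functor.isZero_iff F).2 fun _ => AddCommGrpCat.isZero_iff_subsingleton.2 (h _)

namespace Submod

variable {F F' : C ⥤ AddCommGrpCat.{v}}

/-- The inverse image of a submodule under a morphism of modules. -/
def comap (η : F ⟶ F') (N : Submod F') : Submod F where
  carrier X := (N.carrier X).comap (η.app X).hom
  map_mem f x hx := by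
    rw [AddSubgroup.mem_comap, NatTrans.naturality_apply]
    exact N.map_mem f _ hx

/-- The image of a submodule under a morphism of modules. -/
def map (η : F ⟶ F') (N : Submod F) : Submod F' where
  carrier X := (N.carrier X).map (η.app X).hom
  map_mem {X Y} f := by
    rintro _ ⟨x, hx, rfl⟩
    exact ⟨(F.map f).hom x, N.map_mem f x hx, NatTrans.naturality_apply η f x⟩

/-- The restriction of a submodule along a functor. -/
def precomp {D : Type u₁} [Category.{v} D] (G : D ⥤ C) (N : Submod F) : Submod (G ⋙ F) where
  carrier X := N.carrier (G.obj X)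
  map_mem f x hx := N.map_mem (G.map f) x hx

/-- The morphism `F / η⁻¹(N) ⟶ F' / N` induced by `η : F ⟶ F'`. -/
def quotComapHom (η : F ⟶ F') (N : Submod F') : (N.comap η).quot ⟶ N.quot where
  app X := AddCommGrpCat.ofHom (QuotientAddGroup.map _ _ (η.app X).hom le_rfl)
  naturality X Y f := by
    ext q
    obtain ⟨x, rfl⟩ := QuotientAddGroup.mk_surjective q
    exact congrArg QuotientAddGroup.mk (NatTrans.naturality_apply η f x)

theorem isIso_quotComapHom (η : F ⟶ F') (hη : ∀ X, Function.Surjective (η.app X).hom)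
    (N : Submod F') : IsIso (quotComapHom η N) := by
  refine isIso_of_bijective_app _ fun X => ⟨(injective_iff_map_eq_zero _).2 fun q hq => ?_,
    QuotientAddGroup.map_surjective_of_surjective _ _ _
      (QuotientAddGroup.mk_surjective.comp (hη X)) le_rfl⟩
  obtain ⟨x, rfl⟩ := QuotientAddGroup.mk_surjective q
  exact (QuotientAddGroup.eq_zero_iff x).2 ((QuotientAddGroup.eq_zero_iff ((η.app X).hom x)).1 hq)

/-- The isomorphism `F / η⁻¹(N) ≅ F' / N` for an epimorphism `η : F ⟶ F'`. -/
def quotComapIso (η : F ⟶ F') (hη : ∀ X, Function.Surjective (η.app X).hom) (N : Submod F') :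
    (N.comap η).quot ≅ N.quot :=
  haveI := isIso_quotComapHom η hη N
  asIso (quotComapHom η N)

/-- The isomorphism `η⁻¹(N) / η⁻¹(L) ≅ N / L` for an epimorphism `η`. -/
def subquotComapIso (η : F ⟶ F') (hη : ∀ X, Function.Surjective (η.app X).hom)
    (L N : Submod F') : subquot (L.comap η) (N.comap η) ≅ subquot L N :=
  let restricted : (N.comap η).toFunctor ⟶ N.toFunctor :=
    { app X := AddCommGrpCat.ofHom ((η.app X).hom.addSubgroupComap (N.carrier X))
      naturality _ _ f := by
        ext x
        exact Subtype.ext (NatTrans.naturality_apply η f x.1) }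
  quotComapIso restricted
    (fun X => AddMonoidHom.addSubgroupComap_surjective_of_surjective _ _ (hη X)) (L.comap N.ι)

/-- The isomorphism `N / L ≅ η(N) / η(L)` for a monomorphism `η`. -/
def subquotMapIso (η : F ⟶ F') (hη : ∀ X, Function.Injective (η.app X).hom)
    (L N : Submod F) : subquot L N ≅ subquot (L.map η) (N.map η) :=
  let restricted : N.toFunctor ⟶ (N.map η).toFunctor :=
    { app X := AddCommGrpCat.ofHom ((η.app X).hom.addSubgroupMap (N.carrier X))
      naturality _ _ f := by
        ext x
        exact Subtype.ext (NatTrans.naturality_apply η f x.1) }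
  have comap_map (X : C) : ((L.map η).carrier X).comap (η.app X).hom = L.carrier X :=
    AddSubgroup.comap_map_eq_self_of_injective (hη X) _
  eqToIso (congrArg quot (Submod.ext (funext fun X =>
    congrArg (fun A => A.addSubgroupOf (N.carrier X)) (comap_map X).symm))) ≪≫
    quotComapIso restricted (fun X => AddMonoidHom.addSubgroupMap_surjective _ _)
      ((L.map η).comap (N.map η).ι)

theorem isZero_subquot {L N : Submod F} (h : ∀ X, N.carrier X ≤ L.carrier X) :
    IsZero (subquot L N) :=
  isZero_of_subsingleton_obj fun X => by
    change Subsingleton (N.carrier X ⧸ (L.carrier X).addSubgroupOf (N.carrier X))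
    rw [AddSubgroup.addSubgroupOf_eq_top.2 (h X)]
    exact QuotientAddGroup.subsingleton_quotient_top

theorem isZero_comp_toFunctor {D : Type u₁} [Category.{v} D] (G : D ⥤ C) (N : Submod F)
    (h : ∀ d, N.carrier (G.obj d) = ⊥) : IsZero (G ⋙ N.toFunctor) :=
  isZero_of_subsingleton_obj fun d => by
    change Subsingleton (N.carrier (G.obj d))
    rw [h d]
    infer_instance

theorem isIso_whiskerLeft_ι {D : Type u₁} [Category.{v} D] (G : D ⥤ C) (N : Submod F)
    (h : ∀ d, N.carrier (G.obj d) = ⊤) : IsIso (Functor.whiskerLeft G N.ι) :=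
  isIso_of_bijective_app _ fun d => ⟨Subtype.val_injective, fun x =>
    ⟨⟨x, (h d).symm ▸ AddSubgroup.mem_top x⟩, rfl⟩⟩

end Submod

end Modules

/-! ### Finite direct sums and filtrations -/

/-- A biproduct does not change when zero summands are dropped. -/
def biproductIsoSubtype {𝒜 : Type*} [Category 𝒜] [HasZeroMorphisms 𝒜] {J : Type*} (f : J → 𝒜)
    [HasBiproduct f] (p : J → Prop) [HasBiproduct (Subtype.restrict p f)]
    (h : ∀ j, ¬ p j → IsZero (f j)) : ⨁ f ≅ ⨁ Subtype.restrict p f where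
  hom := biproduct.toSubtype f p
  inv := biproduct.fromSubtype f p
  hom_inv_id := by
    classical
    rw [biproduct.toSubtype_fromSubtype]
    refine biproduct.hom_ext' _ _ fun j => ?_
    by_cases hj : p j
    · rw [biproduct.ι_map, if_pos hj, Category.id_comp, Category.comp_id]
    · exact (h j hj).eq_of_src _ _
  inv_hom_id := biproduct.fromSubtype_toSubtype f p

section Filtrations

variable {C : Type u} [Category.{v} C] {𝒳 : (C ⥤ AddCommGrpCat.{v}) → Prop}
  {F F' F'' : C ⥤ AddCommGrpCat.{v}}

theorem FinSum.of_iso (h : FinSum 𝒳 F) (e : F ≅ F') : FinSum 𝒳 F' := by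
  obtain ⟨m, S, hS, ⟨i⟩⟩ := h
  exact ⟨m, S, hS, ⟨e.symm ≪≫ i⟩⟩

theorem FinSum.of_isZero (h : IsZero F) : FinSum 𝒳 F :=
  ⟨0, Fin.elim0, fun i => i.elim0, ⟨h.iso ((IsZero.iff_id_eq_zero _).2
    (biproduct.hom_ext _ _ fun i => i.elim0))⟩⟩

theorem IsChain.of_iso {c : ℕ → Submod F} (hc : IsChain 𝒳 c) (e : F ≅ F') :
    IsChain 𝒳 fun j => (c j).comap e.inv where
  mono j X := AddSubgroup.comap_mono (hc.mono j X)
  zero X := by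
    change ((c 0).carrier X).comap (e.inv.app X).hom = ⊥
    rw [hc.zero, AddMonoidHom.comap_bot, AddMonoidHom.ker_eq_bot_iff]
    exact (bijective_app e.inv X).1
  step j := (hc.step j).of_iso
    (Submod.subquotComapIso e.inv (fun X => (bijective_app e.inv X).2) _ _).symm

theorem Filtered.of_iso (h : Filtered 𝒳 F) (e : F ≅ F') : Filtered 𝒳 F' := by
  obtain ⟨c, hc, exhaustive⟩ := h
  exact ⟨_, hc.of_iso e, fun X x => exhaustive X _⟩

theorem FinFiltered.of_iso (h : FinFiltered 𝒳 F) (e : F ≅ F') : FinFiltered 𝒳 F' := by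
  obtain ⟨c, hc, m, hm⟩ := h
  exact ⟨_, hc.of_iso e, m, fun X =>
    (congrArg (AddSubgroup.comap (e.inv.app X).hom) (hm X)).trans (AddSubgroup.comap_top _)⟩

section Precomp

variable {D : Type u₁} [Category.{v} D] (G : D ⥤ C) {𝒴 : (D ⥤ AddCommGrpCat.{v}) → Prop}

instance : ((Functor.whiskeringLeft D C AddCommGrpCat.{v}).obj G).Additive where
  map_add := rfl

theorem FinSum.precomp (h : ∀ S, 𝒳 S → 𝒴 (G ⋙ S) ∨ IsZero (G ⋙ S)) (hF : FinSum 𝒳 F) :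
    FinSum 𝒴 (G ⋙ F) := by
  obtain ⟨m, S, hS, ⟨i⟩⟩ := hF
  let restriction := (Functor.whiskeringLeft D C AddCommGrpCat.{v}).obj G
  let p (k : Fin m) : Prop := 𝒴 (G ⋙ S k)
  have dropZeros : ⨁ (fun k => G ⋙ S k) ≅ ⨁ Subtype.restrict p fun k => G ⋙ S k :=
    biproductIsoSubtype _ p fun k hk => (h _ (hS k)).resolve_left hk
  obtain ⟨l, ⟨ε⟩⟩ := Finite.exists_equiv_fin (Subtype p)
  exact ⟨l, fun k => G ⋙ S (ε.symm k), fun k => (ε.symm k).2,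
    ⟨restriction.mapIso i ≪≫ restriction.mapBiproduct S ≪≫ dropZeros ≪≫
      (biproduct.whiskerEquiv ε.symm fun _ => Iso.refl _).symm⟩⟩

theorem IsChain.precomp (h : ∀ S, 𝒳 S → 𝒴 (G ⋙ S) ∨ IsZero (G ⋙ S)) {c : ℕ → Submod F}
    (hc : IsChain 𝒳 c) : IsChain 𝒴 fun j => (c j).precomp G where
  mono j X := hc.mono j (G.obj X)
  zero X := hc.zero (G.obj X)
  step j := (hc.step j).precomp G h

theorem Filtered.precomp (h : ∀ S, 𝒳 S → 𝒴 (G ⋙ S) ∨ IsZero (G ⋙ S)) (hF : Filtered 𝒳 F) :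
    Filtered 𝒴 (G ⋙ F) := by
  obtain ⟨c, hc, exhaustive⟩ := hF
  exact ⟨_, hc.precomp G h, fun X x => exhaustive (G.obj X) x⟩

theorem FinFiltered.precomp (h : ∀ S, 𝒳 S → 𝒴 (G ⋙ S) ∨ IsZero (G ⋙ S))
    (hF : FinFiltered 𝒳 F) : FinFiltered 𝒴 (G ⋙ F) := by
  obtain ⟨c, hc, m, hm⟩ := hF
  exact ⟨_, hc.precomp G h, m, fun X => hm (G.obj X)⟩

end Precomp

namespace Submod

variable (i : F' ⟶ F) (π : F ⟶ F'') {d : ℕ → Submod F'} {l : ℕ} {c : ℕ → Submod F''}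

/-- For `0 ⟶ F' ⟶ F ⟶ F'' ⟶ 0`, the sequence of submodules of `F` consisting of the images of
`d 0, …, d l` followed by the inverse images of `c 1, c 2, …`. -/
def concat (d : ℕ → Submod F') (l : ℕ) (c : ℕ → Submod F'') (j : ℕ) : Submod F :=
  if j ≤ l then (d j).map i else (c (j - l)).comap π

theorem concat_of_le {j : ℕ} (h : j ≤ l) : concat i π d l c j = (d j).map i := if_pos h

theorem concat_add (exact : ∀ X, Function.Exact (i.app X).hom (π.app X).hom)
    (hd : ∀ X, (d l).carrier X = ⊤) (hc : ∀ X, (c 0).carrier X = ⊥) (k : ℕ) :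
    concat i π d l c (l + k) = (c k).comap π := by
  rcases k.eq_zero_or_pos with rfl | hk
  · rw [add_zero, concat_of_le i π le_rfl]
    ext1
    funext X
    change ((d l).carrier X).map (i.app X).hom = ((c 0).carrier X).comap (π.app X).hom
    rw [hd, hc, AddMonoidHom.comap_bot, ← AddMonoidHom.range_eq_map]
    exact (exact X).addMonoidHom_ker_eq.symm
  · rw [concat, if_neg (by omega), Nat.add_sub_cancel_left]

end Submod

theorem IsChain.concat {i : F' ⟶ F} {π : F ⟶ F''}
    (injective : ∀ X, Function.Injective (i.app X).hom)
    (exact : ∀ X, Function.Exact (i.app X).hom (π.app X).hom)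
    (surjective : ∀ X, Function.Surjective (π.app X).hom)
    {d : ℕ → Submod F'} (hd : IsChain 𝒳 d) {l : ℕ} (hl : ∀ X, (d l).carrier X = ⊤)
    {c : ℕ → Submod F''} (hc : IsChain 𝒳 c) : IsChain 𝒳 (Submod.concat i π d l c) where
  mono j X := by
    rcases lt_or_ge j l with hj | hj
    · rw [Submod.concat_of_le i π hj.le, Submod.concat_of_le i π hj]
      exact AddSubgroup.map_mono (hd.mono j X)
    · obtain ⟨k, rfl⟩ := Nat.exists_eq_add_of_le hj
      rw [add_assoc, Submod.concat_add i π exact hl hc.zero,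
        Submod.concat_add i π exact hl hc.zero]
      exact AddSubgroup.comap_mono (hc.mono k X)
  zero X := by
    rw [Submod.concat_of_le i π l.zero_le]
    exact (congrArg (AddSubgroup.map (i.app X).hom) (hd.zero X)).trans (AddSubgroup.map_bot _)
  step j := by
    rcases lt_or_ge j l with hj | hj
    · rw [Submod.concat_of_le i π hj.le, Submod.concat_of_le i π hj]
      exact (hd.step j).of_iso (Submod.subquotMapIso i injective _ _)
    · obtain ⟨k, rfl⟩ := Nat.exists_eq_add_of_le hj
      rw [add_assoc, Submod.concat_add i π exact hl hc.zero,
        Submod.concat_add i π exact hl hc.zero]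
      exact (hc.step k).of_iso (Submod.subquotComapIso π surjective _ _).symm

theorem FinFiltered.of_shortExact {i : F' ⟶ F} {π : F ⟶ F''}
    (injective : ∀ X, Function.Injective (i.app X).hom)
    (exact : ∀ X, Function.Exact (i.app X).hom (π.app X).hom)
    (surjective : ∀ X, Function.Surjective (π.app X).hom)
    (h' : FinFiltered 𝒳 F') (h'' : FinFiltered 𝒳 F'') : FinFiltered 𝒳 F := by
  obtain ⟨d, hd, l, hl⟩ := h'
  obtain ⟨c, hc, m, hm⟩ := h''
  refine ⟨_, hd.concat injective exact surjective hl hc, l + m, fun X => ?_⟩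
  rw [Submod.concat_add i π exact hl hc.zero]
  exact (congrArg (AddSubgroup.comap (π.app X).hom) (hm X)).trans (AddSubgroup.comap_top _)

end Filtrations

section Additive

variable {C : Type u} [Category.{v} C] [Preadditive C] {F F' : C ⥤ AddCommGrpCat.{v}}

instance (N : Submod F) [F.Additive] : N.quot.Additive where
  map_add {X Y f g} := by
    ext q
    obtain ⟨x, rfl⟩ := QuotientAddGroup.mk_surjective q
    change QuotientAddGroup.mk ((F.map (f + g)).hom x) =
      QuotientAddGroup.mk ((F.map f).hom x + (F.map g).hom x)
    rw [F.map_add]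
    rfl

theorem isZero_comp_of_isZero_obj {D : Type u₁} [Category.{v} D] (G : D ⥤ C)
    (hG : ∀ d, IsZero (G.obj d)) (S : C ⥤ AddCommGrpCat.{v}) [S.Additive] : IsZero (G ⋙ S) :=
  (Functor.isZero_iff _).2 fun d => S.map_isZero (hG d)

/-! ### Traces -/

theorem trace_le_comap (P : ObjectProperty C) (η : F ⟶ F') (X : C) :
    (trace P F).carrier X ≤ ((trace P F').comap η).carrier X := by
  refine iSup_le fun E => iSup_le fun hE => iSup_le fun ε => ?_
  rintro _ ⟨g, rfl⟩
  exact AddSubgroup.mem_iSup_of_mem E (AddSubgroup.mem_iSup_of_mem hE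
    (AddSubgroup.mem_iSup_of_mem (ε ≫ η) ⟨g, rfl⟩))

theorem comap_trace_of_isIso (P : ObjectProperty C) (η : F ⟶ F') [IsIso η] :
    (trace P F').comap η = trace P F := by
  ext1
  funext X
  refine le_antisymm (fun x hx => ?_) (trace_le_comap P η X)
  have hx' := trace_le_comap P (inv η) X hx
  change ((inv η).app X).hom ((η.app X).hom x) ∈ (trace P F).carrier X at hx'
  have inv_app_app : ((inv η).app X).hom ((η.app X).hom x) = x :=
    Iso.hom_inv_id_app_apply (asIso η) X x
  rwa [inv_app_app] at hx'

/-- The morphism `C(E, -) ⟶ F` that corresponds to an element of `F(E)` in the Yoneda lemma. -/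
def repHom (F : C ⥤ AddCommGrpCat.{v}) [F.Additive] {E : C} (x : F.obj E) : rep E ⟶ F where
  app Y := AddCommGrpCat.ofHom
    { toFun := fun g => (F.map g).hom x
      map_zero' := by rw [F.map_zero]; rfl
      map_add' := fun g g' => by rw [F.map_add]; rfl }
  naturality Y Z f := by
    ext g
    exact Functor.map_comp_apply F (X := E) (Y := Y) g f x

theorem map_mem_trace {P : ObjectProperty C} (F : C ⥤ AddCommGrpCat.{v}) [F.Additive] {E X : C}
    (hE : P E) (f : E ⟶ X) (x : F.obj E) : (F.map f).hom x ∈ (trace P F).carrier X :=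
  AddSubgroup.mem_iSup_of_mem E (AddSubgroup.mem_iSup_of_mem hE
    (AddSubgroup.mem_iSup_of_mem (repHom F x) ⟨f, rfl⟩))

theorem trace_carrier_le {P : ObjectProperty C} {X : C} {N : AddSubgroup (F.obj X)}
    (h : ∀ E : C, P E → ∀ (f : E ⟶ X) (x : F.obj E), (F.map f).hom x ∈ N) :
    (trace P F).carrier X ≤ N := by
  refine iSup_le fun E => iSup_le fun hE => iSup_le fun η => ?_
  rintro _ ⟨g, rfl⟩
  have yoneda : (η.app X).hom g = (F.map g).hom ((η.app E).hom (𝟙 E)) :=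
    (congrArg (η.app X).hom (Category.id_comp (X := E) (Y := X) g).symm).trans
      (NatTrans.naturality_apply η (X := E) (Y := X) g (𝟙 E))
  exact yoneda ▸ h E hE g _

theorem trace_carrier_eq_top {P : ObjectProperty C} (F : C ⥤ AddCommGrpCat.{v}) [F.Additive]
    {X : C} (hX : P X) : (trace P F).carrier X = ⊤ :=
  (AddSubgroup.eq_top_iff' _).2 fun x => by simpa using map_mem_trace F hX (𝟙 X) x

theorem trace_carrier_eq_bot {P : ObjectProperty C} (F : C ⥤ AddCommGrpCat.{v}) [F.Additive]
    {X : C} (h : ∀ E : C, P E → ∀ f : E ⟶ X, f = 0) : (trace P F).carrier X = ⊥ :=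
  le_bot_iff.1 <| trace_carrier_le fun E hE f x => by
    rw [h E hE f, F.map_zero]
    exact zero_mem _

theorem trace_precomp {D : Type u₁} [Category.{v} D] [Preadditive D] (G : D ⥤ C) [G.Additive]
    [F.Additive] {P : ObjectProperty C} {Q : ObjectProperty D} (hQ : ∀ d, Q d → P (G.obj d))
    (hP : ∀ E, P E → ∀ d (f : E ⟶ G.obj d),
      ∃ d', Q d' ∧ ∃ (p : E ⟶ G.obj d') (g : d' ⟶ d), p ≫ G.map g = f) :
    (trace P F).precomp G = trace Q (G ⋙ F) := by
  ext1
  funext d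
  change (trace P F).carrier (G.obj d) = _
  refine le_antisymm (trace_carrier_le fun E hE f x => ?_)
    (trace_carrier_le fun d' hd' g x => map_mem_trace F (hQ d' hd') (G.map g) x)
  obtain ⟨d', hd', p, g, rfl⟩ := hP E hE d f
  rw [Functor.map_comp_apply]
  exact map_mem_trace (G ⋙ F) hd' g ((F.map p).hom x)

/-! ### Standard modules -/

section Standard

variable [HasFiniteBiproducts C] {K : Type w} [Field K] [Linear K C] {𝒞 : AddFiltration C}

theorem TraceFiltered.of_iso (h : TraceFiltered K 𝒞 F) (e : F ≅ F') :
    TraceFiltered K 𝒞 F' := fun j => by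
  refine (h j).of_iso (?_ ≪≫ Submod.subquotComapIso e.hom
    (fun X => (bijective_app e.hom X).2) _ _)
  exact eqToIso (by simp only [traceAt, comap_trace_of_isIso])

theorem AddFiltration.level_mono (𝒞 : AddFiltration C) (X : C) :
    Monotone fun j => 𝒞.level j X :=
  monotone_nat_of_le_succ fun j => 𝒞.mono j X

variable {j : ℕ} {S S' : C ⥤ AddCommGrpCat.{v}}

theorem StandardAt.of_iso (h : StandardAt K 𝒞 j S) (e : S ≅ S') : StandardAt K 𝒞 j S' := by
  obtain ⟨E, indecomposable, mem, notMem, ⟨i⟩⟩ := h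
  exact ⟨E, indecomposable, mem, notMem, ⟨e.symm ≪≫ i⟩⟩

theorem StandardAt.additive (h : StandardAt K 𝒞 j S) : S.Additive := by
  obtain ⟨E, -, -, -, ⟨i⟩⟩ := h
  exact Functor.additive_of_iso i.symm

end Standard

/-- For a full additive functor `R` such that `I(E, -)` consists of the morphisms that `R` maps
into `J`, the quotient of the representable module at `E` by `I` is inflated along `R`. -/
def CatIdeal.quotSubIso {D : Type u₁} [Category.{v} D] [Preadditive D] {K : Type w} [Field K]
    [Linear K C] [Linear K D] (R : C ⥤ D) [R.Additive] [R.Full] (I : CatIdeal K C)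
    (J : CatIdeal K D) (E : C)
    (h : ∀ X (f : E ⟶ X), f ∈ I.carrier E X ↔ R.map f ∈ J.carrier (R.obj E) (R.obj X)) :
    (I.sub E).quot ≅ R ⋙ (J.sub (R.obj E)).quot :=
  let ρ : rep E ⟶ R ⋙ rep (R.obj E) :=
    { app X := AddCommGrpCat.ofHom (R.mapAddHom (X := E) (Y := X))
      naturality _ _ f := by
        ext g
        exact R.map_comp g f }
  have sub_eq : I.sub E = ((J.sub (R.obj E)).precomp R).comap ρ :=
    Submod.ext (funext fun X => AddSubgroup.ext (h X))
  eqToIso (congrArg Submod.quot sub_eq) ≪≫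
    Submod.quotComapIso ρ (fun _ => R.map_surjective) ((J.sub (R.obj E)).precomp R)

end Additive

/-! ### Indecomposable objects -/

section Indecomposable

variable {C : Type u} [Category.{v} C] [Preadditive C] [HasBinaryBiproducts C]

theorem indecomposable_of_iso {X Y : C} (e : X ≅ Y) (h : Indecomposable X) : Indecomposable Y :=
  ⟨fun hY => h.1 (hY.of_iso e), fun A B i => h.2 A B (e ≪≫ i)⟩

theorem indecomposable_of_map {D : Type u₁} [Category.{v} D] [Preadditive D]
    [HasBinaryBiproducts D] (R : C ⥤ D) [R.Additive] {X : C}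
    (hR : ∀ Y, Nonempty (Retract Y X) → IsZero (R.obj Y) → IsZero Y)
    (h : Indecomposable (R.obj X)) : Indecomposable X := by
  refine ⟨fun hX => h.1 (R.map_isZero hX), fun Y Z e => ?_⟩
  have := preservesBinaryBiproduct_of_preservesBiproduct R Y Z
  have retractY : Retract Y X := ⟨biprod.inl ≫ e.inv, e.hom ≫ biprod.fst, by simp⟩
  have retractZ : Retract Z X := ⟨biprod.inr ≫ e.inv, e.hom ≫ biprod.snd, by simp⟩
  exact (h.2 _ _ (R.mapIso e ≪≫ R.mapBiprod Y Z)).imp (hR Y ⟨retractY⟩) (hR Z ⟨retractZ⟩)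

end Indecomposable

/-! ### Objects of a triangular matrix category -/

section Triangular

variable {K : Type w} [Field K]
  {T : Type u₁} [Category.{v} T] [Preadditive T] [Linear K T]
  {U : Type u₂} [Category.{v} U] [Preadditive U] [Linear K U]

namespace Bimod

variable {M : Bimod K T U} {t : T} {u : U}

theorem subsingleton_val_of_isZero_left (ht : IsZero t) : Subsingleton (M.val t u) :=
  subsingleton_of_forall_eq 0 fun m => by
    rw [← right_id m, ht.eq_of_src (𝟙 t) 0, right_zero]

theorem subsingleton_val_of_isZero_right (hu : IsZero u) : Subsingleton (M.val t u) :=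
  subsingleton_of_forall_eq 0 fun m => by
    rw [← left_id m, hu.eq_of_src (𝟙 u) 0, left_zero]

end Bimod

namespace Tri

variable {M : Bimod K T U}

instance : (fstFunctor M).Full where
  map_surjective f := ⟨⟨f, 0, 0⟩, rfl⟩

instance : (sndFunctor M).Full where
  map_surjective g := ⟨⟨0, 0, g⟩, rfl⟩

theorem hom_ext_of_isZero_fst {X Y : Tri M} (hX : IsZero X.fst) {a b : X ⟶ Y} (h : a.g = b.g) :
    a = b :=
  hom_ext (hX.eq_of_src _ _) ((Bimod.subsingleton_val_of_isZero_left hX).elim _ _) h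

theorem hom_ext_of_isZero_snd {X Y : Tri M} (hY : IsZero Y.snd) {a b : X ⟶ Y} (h : a.f = b.f) :
    a = b :=
  hom_ext h ((Bimod.subsingleton_val_of_isZero_right hY).elim _ _) (hY.eq_of_tgt _ _)

theorem isZero_inT_obj_iff [HasFiniteBiproducts U] {t : T} : IsZero ((inT M).obj t) ↔ IsZero t :=
  (isZero_iff _).trans (and_iff_left (isZero_zero U))

theorem isZero_inU_obj_iff [HasFiniteBiproducts T] {u : U} : IsZero ((inU M).obj u) ↔ IsZero u :=
  (isZero_iff _).trans (and_iff_right (isZero_zero T))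

/-- The projection `(t 0; M u) ⟶ (t 0; M 0)`. -/
def projT [HasFiniteBiproducts U] (X : Tri M) : X ⟶ (inT M).obj X.fst := ⟨𝟙 X.fst, 0, 0⟩

/-- The projection `(t 0; M u) ⟶ (0 0; M u)`. -/
def projU [HasFiniteBiproducts T] (X : Tri M) : X ⟶ (inU M).obj X.snd := ⟨0, 0, 𝟙 X.snd⟩

theorem comp_projT [HasFiniteBiproducts U] {X Y : Tri M} (a : X ⟶ Y) :
    a ≫ Y.projT = X.projT ≫ (inT M).map a.f :=
  hom_ext_of_isZero_snd (isZero_zero U)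
    ((Category.comp_id a.f).trans (Category.id_comp a.f).symm)

theorem projT_comp_map [HasFiniteBiproducts U] {X : Tri M} {t : T} (a : X ⟶ (inT M).obj t) :
    X.projT ≫ (inT M).map (X := X.fst) (Y := t) a.f = a :=
  hom_ext_of_isZero_snd (isZero_zero U) (Category.id_comp (X := X.fst) (Y := t) a.f)

theorem projU_comp_map [HasFiniteBiproducts T] {X : Tri M} (hX : IsZero X.fst) {u : U}
    (a : X ⟶ (inU M).obj u) :
    X.projU ≫ (inU M).map (X := X.snd) (Y := u) a.g = a :=
  hom_ext_of_isZero_fst hX (Category.id_comp (X := X.snd) (Y := u) a.g)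

variable [HasFiniteBiproducts T] [HasFiniteBiproducts U]

/-- The morphism `(t 0; M 0) ⟶ (0 0; M u)` with lower left entry `m`. -/
def lower {t : T} {u : U} (m : M.val t u) : (inT M).obj t ⟶ (inU M).obj u := ⟨0, m, 0⟩

/-- The decomposition of `(t 0; M u)` as the direct sum of `(t 0; M 0)` and `(0 0; M u)`. -/
def bicone (X : Tri M) : BinaryBicone ((inT M).obj X.fst) ((inU M).obj X.snd) where
  pt := X
  fst := X.projT
  snd := X.projU
  inl := ⟨𝟙 X.fst, 0, 0⟩
  inr := ⟨0, 0, 𝟙 X.snd⟩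
  inl_fst := hom_ext_of_isZero_snd (isZero_zero U) (Category.comp_id (𝟙 X.fst))
  inl_snd := by
    apply hom_ext
    · exact comp_zero
    · exact (congrArg₂ (· + ·) (map_zero _) (map_zero _)).trans (add_zero _)
    · exact zero_comp
  inr_fst := hom_ext_of_isZero_snd (isZero_zero U) zero_comp
  inr_snd := hom_ext_of_isZero_fst (isZero_zero T) (Category.comp_id (𝟙 X.snd))

theorem bicone_total (X : Tri M) :
    X.bicone.fst ≫ X.bicone.inl + X.bicone.snd ≫ X.bicone.inr = 𝟙 X := by
  apply hom_ext
  · change 𝟙 X.fst ≫ 𝟙 X.fst + (0 : X.fst ⟶ 0) ≫ (0 : (0 : T) ⟶ X.fst) = 𝟙 X.fst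
    simp
  · change (M.right (𝟙 X.fst) (0 : M.val X.fst X.snd) +
        M.left (0 : (0 : U) ⟶ X.snd) (0 : M.val X.fst 0)) +
      (M.right (0 : X.fst ⟶ (0 : T)) (0 : M.val 0 X.snd) +
        M.left (𝟙 X.snd) (0 : M.val X.fst X.snd)) = (0 : M.val X.fst X.snd)
    simp
  · change (0 : X.snd ⟶ 0) ≫ (0 : (0 : U) ⟶ X.snd) + 𝟙 X.snd ≫ 𝟙 X.snd = 𝟙 X.snd
    simp

theorem comp_projU {X Y : Tri M} (a : X ⟶ Y) :
    a ≫ Y.projU = X.projT ≫ lower a.m + X.projU ≫ (inU M).map a.g := by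
  apply hom_ext
  · change a.f ≫ (0 : Y.fst ⟶ 0) = 𝟙 X.fst ≫ (0 : X.fst ⟶ 0) + (0 : X.fst ⟶ 0) ≫ (0 : (0 : T) ⟶ 0)
    simp
  · change (M.right a.f (0 : M.val Y.fst Y.snd) + M.left (𝟙 Y.snd) a.m : M.val X.fst Y.snd) =
      (M.right (𝟙 X.fst) a.m + M.left (0 : (0 : U) ⟶ Y.snd) (0 : M.val X.fst 0)) +
        (M.right (0 : X.fst ⟶ (0 : T)) (0 : M.val 0 Y.snd) +
          M.left a.g (0 : M.val X.fst X.snd))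
    simp
  · change a.g ≫ 𝟙 Y.snd = (0 : X.snd ⟶ 0) ≫ (0 : (0 : U) ⟶ Y.snd) + 𝟙 X.snd ≫ a.g
    simp

/-- An object with zero second component lies in the image of `inT`. -/
def isoInT (X : Tri M) (hX : IsZero X.snd) : X ≅ (inT M).obj X.fst where
  hom := X.projT
  inv := X.bicone.inl
  hom_inv_id := hom_ext_of_isZero_snd hX (Category.comp_id (𝟙 X.fst))
  inv_hom_id := X.bicone.inl_fst

/-- An object with zero first component lies in the image of `inU`. -/
def isoInU (X : Tri M) (hX : IsZero X.fst) : X ≅ (inU M).obj X.snd where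
  hom := X.projU
  inv := X.bicone.inr
  hom_inv_id := hom_ext_of_isZero_fst hX (Category.comp_id (𝟙 X.snd))
  inv_hom_id := X.bicone.inr_snd

theorem isZero_fst_or_isZero_snd {X : Tri M} (h : Indecomposable X) :
    IsZero X.fst ∨ IsZero X.snd :=
  (h.2 _ _ (biprod.uniqueUpToIso _ _ (isBinaryBilimitOfTotal X.bicone X.bicone_total))).imp
    isZero_inT_obj_iff.1 isZero_inU_obj_iff.1

theorem indecomposable_fst_iff {X : Tri M} (hX : IsZero X.snd) :
    Indecomposable X.fst ↔ Indecomposable X := by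
  refine ⟨indecomposable_of_map (fstFunctor M) ?_, fun h => indecomposable_of_map (inT M)
    (fun _ _ => isZero_inT_obj_iff.1) (indecomposable_of_iso (X.isoInT hX) h)⟩
  rintro Y ⟨r⟩ hY
  have hY' : IsZero ((sndFunctor M).obj Y) := IsZero.of_mono ((sndFunctor M).map r.i) hX
  exact (isZero_iff Y).2 ⟨hY, hY'⟩

theorem indecomposable_snd_iff {X : Tri M} (hX : IsZero X.fst) :
    Indecomposable X.snd ↔ Indecomposable X := by
  refine ⟨indecomposable_of_map (sndFunctor M) ?_, fun h => indecomposable_of_map (inU M)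
    (fun _ _ => isZero_inU_obj_iff.1) (indecomposable_of_iso (X.isoInU hX) h)⟩
  rintro Y ⟨r⟩ hY
  have hY' : IsZero ((fstFunctor M).obj Y) := IsZero.of_mono ((fstFunctor M).map r.i) hX
  exact (isZero_iff Y).2 ⟨hY', hY⟩

end Tri

end Triangular

/-! ### The filtration of a triangular matrix category -/

section Filtration

variable {K : Type w} [Field K]
  {T : Type u₁} [Category.{v} T] [Preadditive T] [Linear K T] [HasFiniteBiproducts T]
  {U : Type u₂} [Category.{v} U] [Preadditive U] [Linear K U] [HasFiniteBiproducts U]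
  {M : Bimod K T U} {𝒯 : AddFiltration T} {𝒰 : AddFiltration U} {n : ℕ} {hn : ∀ u, 𝒰.level n u}
  {j : ℕ}

theorem AddFiltration.level_of_isZero (𝒰 : AddFiltration U) (j : ℕ) {u : U} (hu : IsZero u) :
    𝒰.level j u :=
  𝒰.level_mono u j.zero_le ((𝒰.zero_iff u).2 hu)

theorem StandardAt.lt (hn : ∀ u, 𝒰.level n u) {S : U ⥤ AddCommGrpCat.{v}}
    (h : StandardAt K 𝒰 j S) : j < n := by
  obtain ⟨E, -, -, notMem, -⟩ := h
  exact lt_of_not_ge fun hj => notMem (𝒰.level_mono E hj (hn E))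

namespace Tri

theorem level_filtration_of_le (hj : j ≤ n) {X : Tri M} :
    (filtration M 𝒯 𝒰 n hn).level j X ↔ IsZero X.fst ∧ 𝒰.level j X.snd :=
  iff_of_eq (if_pos hj)

theorem level_filtration_add {X : Tri M} :
    (filtration M 𝒯 𝒰 n hn).level (n + j) X ↔ 𝒯.level j X.fst := by
  rcases j.eq_zero_or_pos with rfl | hj
  · rw [add_zero, level_filtration_of_le le_rfl, 𝒯.zero_iff]
    exact and_iff_left (hn _)
  · change (if n + j ≤ n then _ else _) ↔ _
    rw [if_neg (by omega), Nat.add_sub_cancel_left]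

theorem mem_ideal_filtration_add {X Y : Tri M} (a : X ⟶ Y) :
    a ∈ ((filtration M 𝒯 𝒰 n hn).ideal K (n + j)).carrier X Y ↔
      a.f ∈ (𝒯.ideal K j).carrier X.fst Y.fst := by
  constructor
  · rintro ⟨E, b, c, hE, rfl⟩
    exact ⟨E.fst, b.f, c.f, level_filtration_add.1 hE, rfl⟩
  · rintro ⟨t, b, c, ht, hbc⟩
    let p : X ⟶ ⟨t, Y.snd⟩ := ⟨b, a.m, a.g⟩
    let q : (⟨t, Y.snd⟩ : Tri M) ⟶ Y := ⟨c, 0, 𝟙 Y.snd⟩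
    exact ⟨_, p, q, level_filtration_add.2 ht, hom_ext hbc (by simp [p, q]) (by simp [p, q])⟩

theorem mem_ideal_filtration_of_le (hj : j ≤ n) {X Y : Tri M} (hX : IsZero X.fst) (a : X ⟶ Y) :
    a ∈ ((filtration M 𝒯 𝒰 n hn).ideal K j).carrier X Y ↔
      a.g ∈ (𝒰.ideal K j).carrier X.snd Y.snd := by
  constructor
  · rintro ⟨E, b, c, hE, rfl⟩
    exact ⟨E.snd, b.g, c.g, ((level_filtration_of_le hj).1 hE).2, rfl⟩
  · rintro ⟨u, b, c, hu, hbc⟩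
    let p : X ⟶ (inU M).obj u := ⟨0, 0, b⟩
    let q : (inU M).obj u ⟶ Y := ⟨0, 0, c⟩
    exact ⟨_, p, q, (level_filtration_of_le hj).2 ⟨isZero_zero T, hu⟩,
      hom_ext_of_isZero_fst hX hbc⟩

/-! ### Standard modules of a triangular matrix category -/

variable {S : Tri M ⥤ AddCommGrpCat.{v}}

theorem standardAt_filtration_add_iff :
    StandardAt K (filtration M 𝒯 𝒰 n hn) (n + j) S ↔
      ∃ S', StandardAt K 𝒯 j S' ∧ Nonempty (S ≅ fstFunctor M ⋙ S') := by
  have inflation (E : Tri M) := CatIdeal.quotSubIso (fstFunctor M)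
    ((filtration M 𝒯 𝒰 n hn).ideal K (n + j)) (𝒯.ideal K j) E fun _ => mem_ideal_filtration_add
  constructor
  · rintro ⟨E, indecomposable, mem, notMem, ⟨i⟩⟩
    have hE : IsZero E.snd := (isZero_fst_or_isZero_snd indecomposable).resolve_left fun h =>
      notMem (level_filtration_add.2 (𝒯.level_of_isZero j h))
    exact ⟨_, ⟨E.fst, (indecomposable_fst_iff hE).2 indecomposable, level_filtration_add.1 mem,
      fun h => notMem (level_filtration_add.2 h), ⟨Iso.refl _⟩⟩, ⟨i ≪≫ inflation E⟩⟩
  · rintro ⟨S', ⟨t, indecomposable, mem, notMem, ⟨i⟩⟩, ⟨e⟩⟩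
    exact ⟨(inT M).obj t, (indecomposable_fst_iff (isZero_zero U)).1 indecomposable,
      (level_filtration_add (j := j + 1)).2 mem, fun h => notMem (level_filtration_add.1 h),
      ⟨e ≪≫ Functor.isoWhiskerLeft _ i ≪≫ (inflation ((inT M).obj t)).symm⟩⟩

theorem standardAt_filtration_iff_of_lt (hj : j < n) :
    StandardAt K (filtration M 𝒯 𝒰 n hn) j S ↔
      ∃ S', StandardAt K 𝒰 j S' ∧ Nonempty (S ≅ sndFunctor M ⋙ S') := by
  have inflation (E : Tri M) (hE : IsZero E.fst) := CatIdeal.quotSubIso (sndFunctor M)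
    ((filtration M 𝒯 𝒰 n hn).ideal K j) (𝒰.ideal K j) E
    fun _ => mem_ideal_filtration_of_le hj.le hE
  constructor
  · rintro ⟨E, indecomposable, mem, notMem, ⟨i⟩⟩
    obtain ⟨hE, mem⟩ := (level_filtration_of_le hj).1 mem
    exact ⟨_, ⟨E.snd, (indecomposable_snd_iff hE).2 indecomposable, mem,
      fun h => notMem ((level_filtration_of_le hj.le).2 ⟨hE, h⟩), ⟨Iso.refl _⟩⟩,
      ⟨i ≪≫ inflation E hE⟩⟩
  · rintro ⟨S', ⟨u, indecomposable, mem, notMem, ⟨i⟩⟩, ⟨e⟩⟩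
    exact ⟨(inU M).obj u, (indecomposable_snd_iff (isZero_zero T)).1 indecomposable,
      (level_filtration_of_le hj).2 ⟨isZero_zero T, mem⟩,
      fun h => notMem ((level_filtration_of_le hj.le).1 h).2,
      ⟨e ≪≫ Functor.isoWhiskerLeft _ i ≪≫ (inflation ((inU M).obj u) (isZero_zero T)).symm⟩⟩

theorem standardAt_inT_comp (h : StandardAt K (filtration M 𝒯 𝒰 n hn) (n + j) S) :
    StandardAt K 𝒯 j (inT M ⋙ S) := by
  obtain ⟨S', hS', ⟨e⟩⟩ := standardAt_filtration_add_iff.1 h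
  exact hS'.of_iso (Functor.isoWhiskerLeft (inT M) e).symm

theorem isZero_inU_comp (h : StandardAt K (filtration M 𝒯 𝒰 n hn) (n + j) S) :
    IsZero (inU M ⋙ S) := by
  obtain ⟨S', hS', ⟨e⟩⟩ := standardAt_filtration_add_iff.1 h
  have := hS'.additive
  exact (isZero_comp_of_isZero_obj (inU M ⋙ fstFunctor M) (fun _ => isZero_zero T) S').of_iso
    (Functor.isoWhiskerLeft (inU M) e)

theorem standardAt_inU_comp (hj : j < n) (h : StandardAt K (filtration M 𝒯 𝒰 n hn) j S) :
    StandardAt K 𝒰 j (inU M ⋙ S) := by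
  obtain ⟨S', hS', ⟨e⟩⟩ := (standardAt_filtration_iff_of_lt hj).1 h
  exact hS'.of_iso (Functor.isoWhiskerLeft (inU M) e).symm

theorem isZero_inT_comp (hj : j < n) (h : StandardAt K (filtration M 𝒯 𝒰 n hn) j S) :
    IsZero (inT M ⋙ S) := by
  obtain ⟨S', hS', ⟨e⟩⟩ := (standardAt_filtration_iff_of_lt hj).1 h
  have := hS'.additive
  exact (isZero_comp_of_isZero_obj (inT M ⋙ sndFunctor M) (fun _ => isZero_zero U) S').of_iso
    (Functor.isoWhiskerLeft (inT M) e)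

theorem standard_inT_comp_or_isZero (S : Tri M ⥤ AddCommGrpCat.{v})
    (h : Standard K (filtration M 𝒯 𝒰 n hn) S) :
    Standard K 𝒯 (inT M ⋙ S) ∨ IsZero (inT M ⋙ S) := by
  obtain ⟨j, hS⟩ := h
  rcases lt_or_ge j n with hj | hj
  · exact Or.inr (isZero_inT_comp hj hS)
  · obtain ⟨k, rfl⟩ := Nat.exists_eq_add_of_le hj
    exact Or.inl ⟨k, standardAt_inT_comp hS⟩

theorem standard_inU_comp_or_isZero (S : Tri M ⥤ AddCommGrpCat.{v})
    (h : Standard K (filtration M 𝒯 𝒰 n hn) S) :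
    Standard K 𝒰 (inU M ⋙ S) ∨ IsZero (inU M ⋙ S) := by
  obtain ⟨j, hS⟩ := h
  rcases lt_or_ge j n with hj | hj
  · exact Or.inl ⟨j, standardAt_inU_comp hj hS⟩
  · obtain ⟨k, rfl⟩ := Nat.exists_eq_add_of_le hj
    exact Or.inr (isZero_inU_comp hS)

theorem standard_fstFunctor_comp {S : T ⥤ AddCommGrpCat.{v}} (h : Standard K 𝒯 S) :
    Standard K (filtration M 𝒯 𝒰 n hn) (fstFunctor M ⋙ S) := by
  obtain ⟨j, hS⟩ := h
  exact ⟨n + j, standardAt_filtration_add_iff.2 ⟨S, hS, ⟨Iso.refl _⟩⟩⟩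

theorem standard_sndFunctor_comp {S : U ⥤ AddCommGrpCat.{v}} (h : Standard K 𝒰 S) :
    Standard K (filtration M 𝒯 𝒰 n hn) (sndFunctor M ⋙ S) := by
  obtain ⟨j, hS⟩ := h
  exact ⟨j, (standardAt_filtration_iff_of_lt (hS.lt hn)).2 ⟨S, hS, ⟨Iso.refl _⟩⟩⟩

/-! ### Trace filtrations over a triangular matrix category -/

variable (F : Tri M ⥤ AddCommGrpCat.{v}) [F.Additive]

theorem traceAt_precomp_inT :
    (traceAt (filtration M 𝒯 𝒰 n hn) F (n + j)).precomp (inT M) = traceAt 𝒯 (inT M ⋙ F) j :=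
  trace_precomp (inT M) (fun _ ht => level_filtration_add.2 ht) fun E hE _ a =>
    ⟨E.fst, level_filtration_add.1 hE, E.projT, a.f, projT_comp_map a⟩

theorem traceAt_precomp_inU (hj : j ≤ n) :
    (traceAt (filtration M 𝒯 𝒰 n hn) F j).precomp (inU M) = traceAt 𝒰 (inU M ⋙ F) j :=
  trace_precomp (inU M) (fun _ hu => (level_filtration_of_le hj).2 ⟨isZero_zero T, hu⟩)
    fun E hE _ a => by
      obtain ⟨hE₁, hE₂⟩ := (level_filtration_of_le hj).1 hE
      exact ⟨E.snd, hE₂, E.projU, a.g, projU_comp_map hE₁ a⟩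

theorem traceAt_carrier_inT_eq_bot (hj : j ≤ n) (t : T) :
    (traceAt (filtration M 𝒯 𝒰 n hn) F j).carrier ((inT M).obj t) = ⊥ :=
  trace_carrier_eq_bot F fun _ hE a =>
    hom_ext_of_isZero_fst ((level_filtration_of_le hj).1 hE).1
      ((isZero_zero U).eq_of_tgt a.g 0)

theorem traceAt_carrier_inU_eq_top (hj : n ≤ j) (u : U) :
    (traceAt (filtration M 𝒯 𝒰 n hn) F j).carrier ((inU M).obj u) = ⊤ := by
  obtain ⟨k, rfl⟩ := Nat.exists_eq_add_of_le hj
  exact trace_carrier_eq_top F (level_filtration_add.2 (𝒯.zero_mem k))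

variable {F}

theorem traceFiltered_inT_comp (h : TraceFiltered K (filtration M 𝒯 𝒰 n hn) F) :
    TraceFiltered K 𝒯 (inT M ⋙ F) := fun j => by
  rw [← traceAt_precomp_inT (hn := hn), ← traceAt_precomp_inT (hn := hn)]
  exact (h (n + j)).precomp (inT M) fun S hS => Or.inl (standardAt_inT_comp hS)

theorem traceFiltered_inU_comp (h : TraceFiltered K (filtration M 𝒯 𝒰 n hn) F) :
    TraceFiltered K 𝒰 (inU M ⋙ F) := fun j => by
  rcases lt_or_ge j n with hj | hj
  · rw [← traceAt_precomp_inU (𝒯 := 𝒯) (hn := hn) F hj.le,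
      ← traceAt_precomp_inU (𝒯 := 𝒯) (hn := hn) F hj]
    exact (h j).precomp (inU M) fun S hS => Or.inl (standardAt_inU_comp hj hS)
  · exact FinSum.of_isZero (Submod.isZero_subquot fun u =>
      (trace_carrier_eq_top (inU M ⋙ F) (𝒰.level_mono u hj (hn u))).symm ▸ le_top)

end Tri

end Filtration

/-! ### Modules over a triangular matrix category as triples -/

theorem bijective_map_fst_prod_map_snd {C : Type u} [Category.{v} C] [Preadditive C]
    (F : C ⥤ AddCommGrpCat.{v}) [F.Additive] {X Y : C} (b : BinaryBicone X Y)
    (total : b.fst ≫ b.inl + b.snd ≫ b.inr = 𝟙 b.pt) :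
    Function.Bijective ((F.map b.fst).hom.prod (F.map b.snd).hom) := by
  refine Function.bijective_iff_has_inverse.2
    ⟨fun p => (F.map b.inl).hom p.1 + (F.map b.inr).hom p.2, fun x => ?_, fun p => ?_⟩
  · change (F.map b.inl).hom ((F.map b.fst).hom x) + (F.map b.inr).hom ((F.map b.snd).hom x) = x
    rw [← Functor.map_comp_apply, ← Functor.map_comp_apply, ← AddMonoidHom.add_apply,
      ← AddCommGrpCat.hom_add, ← F.map_add, total, F.map_id]
    rfl
  · ext <;> simp [← Functor.map_comp_apply]

section Triples

variable {K : Type w} [Field K]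
  {T : Type u₁} [Category.{v} T] [Preadditive T] [Linear K T]
  {U : Type u₂} [Category.{v} U] [Preadditive U] [Linear K U]

namespace Triple

variable {M : Bimod K T U} (A : Triple M)

/-- The inclusion of the inflation of `F₂` into the module of the triple `(F₁, f, F₂)`. -/
def inr : Tri.sndFunctor M ⋙ A.snd ⟶ A.toModule where
  app X := AddCommGrpCat.ofHom (AddMonoidHom.inr (A.fst.obj X.fst) (A.snd.obj X.snd))
  naturality X Y a := by
    ext y
    refine Prod.ext (map_zero (A.fst.map a.f).hom).symm ?_
    change (A.snd.map a.g).hom y = A.act X.fst Y.snd 0 a.m + (A.snd.map a.g).hom y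
    rw [act_zero_left, zero_add]

/-- The projection of the module of the triple `(F₁, f, F₂)` onto the inflation of `F₁`. -/
def projFst : A.toModule ⟶ Tri.fstFunctor M ⋙ A.fst where
  app X := AddCommGrpCat.ofHom (AddMonoidHom.fst (A.fst.obj X.fst) (A.snd.obj X.snd))

theorem isIso_whiskerLeft_inT_projFst [HasFiniteBiproducts U] :
    IsIso (Functor.whiskerLeft (Tri.inT M) A.projFst) :=
  isIso_of_bijective_app _ fun t => by
    have : Subsingleton (A.snd.obj 0) :=
      AddCommGrpCat.subsingleton_of_isZero (A.snd.map_isZero (isZero_zero U))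
    exact ⟨fun x y h => Prod.ext h (this.elim x.2 y.2), fun x => ⟨(x, 0), rfl⟩⟩

theorem isIso_whiskerLeft_inU_inr [HasFiniteBiproducts T] :
    IsIso (Functor.whiskerLeft (Tri.inU M) A.inr) :=
  isIso_of_bijective_app _ fun u => by
    have : Subsingleton (A.fst.obj 0) :=
      AddCommGrpCat.subsingleton_of_isZero (A.fst.map_isZero (isZero_zero T))
    exact ⟨fun x y h => congrArg Prod.snd h, fun x => ⟨x.2, Prod.ext (this.elim 0 x.1) rfl⟩⟩

/-- Restricting the module of the triple `(F₁, f, F₂)` to `T` recovers `F₁`. -/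
def inTCompToModuleIso [HasFiniteBiproducts U] : Tri.inT M ⋙ A.toModule ≅ A.fst :=
  haveI := A.isIso_whiskerLeft_inT_projFst
  show Tri.inT M ⋙ A.toModule ≅ Tri.inT M ⋙ Tri.fstFunctor M ⋙ A.fst from
    asIso (Functor.whiskerLeft (Tri.inT M) A.projFst)

/-- Restricting the module of the triple `(F₁, f, F₂)` to `U` recovers `F₂`. -/
def inUCompToModuleIso [HasFiniteBiproducts T] : Tri.inU M ⋙ A.toModule ≅ A.snd :=
  haveI := A.isIso_whiskerLeft_inU_inr
  (asIso (Functor.whiskerLeft (Tri.inU M) A.inr)).symm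

variable [HasFiniteBiproducts T] [HasFiniteBiproducts U]

/-- The comparison of a module with the module of its triple, which at `X = (t 0; M u)` is
`F(X) ⟶ F(t 0; M 0) × F(0 0; M u)`. -/
def comparison (F : Tri M ⥤ AddCommGrpCat.{v}) [F.Additive] : F ⟶ (ofModule F).toModule where
  app X := AddCommGrpCat.ofHom ((F.map X.projT).hom.prod (F.map X.projU).hom)
  naturality X Y a := by
    ext x
    apply Prod.ext
    · change (F.map Y.projT).hom ((F.map a).hom x) =
        (F.map ((Tri.inT M).map a.f)).hom ((F.map X.projT).hom x)
      rw [← Functor.map_comp_apply, ← Functor.map_comp_apply, Tri.comp_projT]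
    · change (F.map Y.projU).hom ((F.map a).hom x) =
        (F.map (Tri.lower a.m)).hom ((F.map X.projT).hom x) +
          (F.map ((Tri.inU M).map a.g)).hom ((F.map X.projU).hom x)
      rw [← Functor.map_comp_apply, ← Functor.map_comp_apply, ← Functor.map_comp_apply,
        Tri.comp_projU, F.map_add]
      rfl

instance isIso_comparison (F : Tri M ⥤ AddCommGrpCat.{v}) [F.Additive] : IsIso (comparison F) :=
  isIso_of_bijective_app _ fun X => bijective_map_fst_prod_map_snd F X.bicone X.bicone_total

variable {𝒯 : AddFiltration T} {𝒰 : AddFiltration U} {n : ℕ} {hn : ∀ u, 𝒰.level n u} {A}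

theorem finFiltered_toModule (h₁ : FinFiltered (Standard K 𝒯) A.fst)
    (h₂ : FinFiltered (Standard K 𝒰) A.snd) :
    FinFiltered (Standard K (Tri.filtration M 𝒯 𝒰 n hn)) A.toModule :=
  FinFiltered.of_shortExact (i := A.inr) (π := A.projFst)
    (fun _ _ _ h => congrArg Prod.snd h)
    (fun _ x => ⟨fun h => ⟨x.2, Prod.ext (Eq.symm h) rfl⟩, fun ⟨_, h⟩ => h ▸ rfl⟩)
    (fun _ => Prod.fst_surjective)
    (h₂.precomp (Tri.sndFunctor M) fun _ hS => Or.inl (Tri.standard_sndFunctor_comp hS))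
    (h₁.precomp (Tri.fstFunctor M) fun _ hS => Or.inl (Tri.standard_fstFunctor_comp hS))

end Triple

end Triples

end TriQH

end

theorem mainTheorem2_general {K : Type w} [Field K]
    {T : Type u₁} [Category.{v} T] [Preadditive T] [Linear K T] [HasFiniteBiproducts T]
    {U : Type u₂} [Category.{v} U] [Preadditive U] [Linear K U] [HasFiniteBiproducts U]
    (𝒯 : TriQH.AddFiltration T) (𝒰 : TriQH.AddFiltration U)
    (n : ℕ) (hn : ∀ X : U, 𝒰.level n X) (M : TriQH.Bimod K T U)
    (Λ : TriQH.AddFiltration (TriQH.Tri M)) (hΛ : Λ = TriQH.Tri.filtration M 𝒯 𝒰 n hn) :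
    (∀ (F : TriQH.Tri M ⥤ AddCommGrpCat.{v}) [F.Additive],
      Nonempty (F ≅ (TriQH.Triple.ofModule F).toModule)) ∧
    ∀ (F : TriQH.Tri M ⥤ AddCommGrpCat.{v}) [F.Additive] (A : TriQH.Triple M),
      (F ≅ A.toModule) →
      (∀ j, j ≤ n →
        IsZero (TriQH.Triple.ofModule (TriQH.traceAt Λ F j).toFunctor).fst) ∧
      (∀ j, n < j →
        IsIso (Functor.whiskerLeft (TriQH.Tri.inU M) (TriQH.traceAt Λ F j).ι) ∧
        Nonempty ((TriQH.Triple.ofModule (TriQH.traceAt Λ F j).toFunctor).snd ≅ A.snd)) ∧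
      (TriQH.Filtered (TriQH.Standard K Λ) F →
        TriQH.Filtered (TriQH.Standard K 𝒯) A.fst ∧
        TriQH.Filtered (TriQH.Standard K 𝒰) A.snd) ∧
      (TriQH.TraceFiltered K Λ F →
        TriQH.TraceFiltered K 𝒯 A.fst ∧ TriQH.TraceFiltered K 𝒰 A.snd) ∧
      (TriQH.FinFiltered (TriQH.Standard K Λ) F ↔
        TriQH.FinFiltered (TriQH.Standard K 𝒯) A.fst ∧
        TriQH.FinFiltered (TriQH.Standard K 𝒰) A.snd) := by
  subst hΛ
  refine ⟨fun F _ => ⟨asIso (TriQH.Triple.comparison F)⟩, fun F _ A e => ?_⟩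
  have e₁ : TriQH.Tri.inT M ⋙ F ≅ A.fst := Functor.isoWhiskerLeft _ e ≪≫ A.inTCompToModuleIso
  have e₂ : TriQH.Tri.inU M ⋙ F ≅ A.snd := Functor.isoWhiskerLeft _ e ≪≫ A.inUCompToModuleIso
  refine ⟨fun j hj => ?_, fun j hj => ?_, fun h => ⟨?_, ?_⟩, fun h => ⟨?_, ?_⟩, fun h => ⟨?_, ?_⟩,
    fun h => (TriQH.Triple.finFiltered_toModule h.1 h.2).of_iso e.symm⟩
  · exact TriQH.Submod.isZero_comp_toFunctor (TriQH.Tri.inT M) _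
      (TriQH.Tri.traceAt_carrier_inT_eq_bot F hj)
  · have := TriQH.Submod.isIso_whiskerLeft_ι (TriQH.Tri.inU M) _
      (TriQH.Tri.traceAt_carrier_inU_eq_top (𝒯 := 𝒯) (hn := hn) F hj.le)
    have restrictionIso := asIso (Functor.whiskerLeft (TriQH.Tri.inU M)
      (TriQH.traceAt (TriQH.Tri.filtration M 𝒯 𝒰 n hn) F j).ι)
    exact ⟨this, ⟨restrictionIso ≪≫ e₂⟩⟩
  · exact (h.precomp _ TriQH.Tri.standard_inT_comp_or_isZero).of_iso e₁
  · exact (h.precomp _ TriQH.Tri.standard_inU_comp_or_isZero).of_iso e₂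
  · exact (TriQH.Tri.traceFiltered_inT_comp h).of_iso e₁
  · exact (TriQH.Tri.traceFiltered_inU_comp h).of_iso e₂
  · exact (h.precomp _ TriQH.Tri.standard_inT_comp_or_isZero).of_iso e₁
  · exact (h.precomp _ TriQH.Tri.standard_inU_comp_or_isZero).of_iso e₂

theorem mainTheorem2 {K : Type w} [Field K]
    {T : Type u₁} [Category.{v} T] [Preadditive T] [Linear K T] [HasFiniteBiproducts T]
    {U : Type u₂} [Category.{v} U] [Preadditive U] [Linear K U] [HasFiniteBiproducts U]
    (hT : TriQH.HomFinite K T) (hT' : TriQH.KrullSchmidt T)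
    (hU : TriQH.HomFinite K U) (hU' : TriQH.KrullSchmidt U)
    (𝒯 : TriQH.AddFiltration T) (h𝒯 : TriQH.QuasiHereditary K 𝒯)
    (𝒰 : TriQH.AddFiltration U) (h𝒰 : TriQH.QuasiHereditary K 𝒰)
    (n : ℕ) (hn : ∀ X : U, 𝒰.level n X)
    (M : TriQH.Bimod K T U) (hM : ∀ (t : T) (X : U), Module.Finite K (M.val t X))
    (hMΔ : ∀ t : T, TriQH.Filtered (TriQH.Standard K 𝒰) (M.col t))
    (Λ : TriQH.AddFiltration (TriQH.Tri M)) (hΛ : Λ = TriQH.Tri.filtration M 𝒯 𝒰 n hn) :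
    (∀ (F : TriQH.Tri M ⥤ AddCommGrpCat.{v}) [F.Additive],
      Nonempty (F ≅ (TriQH.Triple.ofModule F).toModule)) ∧
    ∀ (F : TriQH.Tri M ⥤ AddCommGrpCat.{v}) [F.Additive] (A : TriQH.Triple M),
      (F ≅ A.toModule) →
      (∀ j, j ≤ n →
        IsZero (TriQH.Triple.ofModule (TriQH.traceAt Λ F j).toFunctor).fst) ∧
      (∀ j, n < j →
        IsIso (Functor.whiskerLeft (TriQH.Tri.inU M) (TriQH.traceAt Λ F j).ι) ∧
        Nonempty ((TriQH.Triple.ofModule (TriQH.traceAt Λ F j).toFunctor).snd ≅ A.snd)) ∧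
      (TriQH.Filtered (TriQH.Standard K Λ) F →
        TriQH.Filtered (TriQH.Standard K 𝒯) A.fst ∧
        TriQH.Filtered (TriQH.Standard K 𝒰) A.snd) ∧
      (TriQH.TraceFiltered K Λ F →
        TriQH.TraceFiltered K 𝒯 A.fst ∧ TriQH.TraceFiltered K 𝒰 A.snd) ∧
      (TriQH.FinFiltered (TriQH.Standard K Λ) F ↔
        TriQH.FinFiltered (TriQH.Standard K 𝒯) A.fst ∧
        TriQH.FinFiltered (TriQH.Standard K 𝒰) A.snd) :=
  mainTheorem2_general 𝒯 𝒰 n hn M Λ hΛ
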